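/- Let $\mathbb B_n=\{z\in\mathbb C^n:|z|<1\}$ be the open unit ball of $\mathbb C^n$, with $\langle z,w\rangle=\sum_k z_k\overline{w_k}$ and $|z|=\langle z,z\rangle^{1/2}$, and let $dv$ be the normalized volume measure on $\mathbb B_n$. For $\alpha>-1$ let $dv_\alpha(z)=c_\alpha(1-|z|^2)^\alpha\,dv(z)$, where $c_\alpha>0$ is chosen so that $v_\alpha(\mathbb B_n)=1$. For $p>0$ let $A^p_\alpha(\mathbb B_n)=L^p(\mathbb B_n,dv_\alpha)\cap H(\mathbb B_n)$, where $H(\mathbb B_n)$ is the space of holomorphic functions on $\mathbb B_n$. For $a\in\mathbb B_n$ let $\varphi_a$ be the involutive automorphism of $\mathbb B_n$ exchanging $0$ and $a$, $$\varphi_a(z)=\frac{a-P_az-\sqrt{1-|a|^2}\,(z-P_az)}{1-\langle z,a\rangle},$$ where $P_a$ is the orthogonal projection of $\mathbb C^n$ onto $\mathbb Ca$ (so $P_0=0$). Put $\rho(z,w)=|\varphi_z(w)|$ and $\beta(z,w)=\frac12\log\frac{1+\rho(z,w)}{1-\rho(z,w)}$ for $z,w\in\mathbb B_n$. Suppose $p>0$,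 $\alpha>-1$, and $f\in H(\mathbb B_n)$. Then the following conditions are equivalent. (a) $f$ belongs to $A^p_\alpha(\mathbb B_n)$. (b) There exists a continuous function $g\in L^p(\mathbb B_n,dv_\alpha)$ such that $|f(z)-f(w)|\le\rho(z,w)(g(z)+g(w))$ for all $z,w\in\mathbb B_n$. (c) There exists a continuous function $g\in L^p(\mathbb B_n,dv_\alpha)$ such that $|f(z)-f(w)|\le\beta(z,w)(g(z)+g(w))$ for all $z,w\in\mathbb B_n$. (d) There exists a continuous function $g\in L^p(\mathbb B_n,dv_{p+\alpha})$ such that $|f(z)-f(w)|\le|z-w|(g(z)+g(w))$ for all $z,w\in\mathbb B_n$. -/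

import Mathlib

open MeasureTheory Metric

/-- The space `ℂⁿ` with its Euclidean (Hermitian) norm. -/
abbrev CSpace (n : ℕ) : Type := EuclideanSpace ℂ (Fin n)

/-- The open unit ball `𝔹ₙ` of `ℂⁿ`. -/
def unitBall (n : ℕ) : Set (CSpace n) := ball 0 1

/-- Normalized volume measure `v` on `𝔹ₙ`, regarded as a measure on `ℂⁿ` carried by `𝔹ₙ`. -/
noncomputable def ballVolume (n : ℕ) : Measure (CSpace n) :=
  (volume (unitBall n))⁻¹ • volume.restrict (unitBall n)

/-- The measure `(1 - |z|²)^α dv(z)`, before normalization. -/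
noncomputable def weightedVolumeAux (n : ℕ) (α : ℝ) : Measure (CSpace n) :=
  (ballVolume n).withDensity fun z => ENNReal.ofReal ((1 - ‖z‖ ^ 2) ^ α)

/-- The weighted volume measure `dv_α(z) = c_α (1 - |z|²)^α dv(z)`, where `c_α` is the reciprocal of
the total mass of `(1 - |z|²)^α dv(z)` (which is positive and finite for `α > -1`). -/
noncomputable def weightedVolume (n : ℕ) (α : ℝ) : Measure (CSpace n) :=
  (weightedVolumeAux n α Set.univ)⁻¹ • weightedVolumeAux n α

/-- Membership in the weighted Bergman space `A^p_α(𝔹ₙ) = L^p(𝔹ₙ, dv_α) ∩ H(𝔹ₙ)`.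
Only the values of `f` on `𝔹ₙ` matter. -/
def MemBergman (n : ℕ) (p α : ℝ) (f : CSpace n → ℂ) : Prop :=
  DifferentiableOn ℂ f (unitBall n) ∧ MemLp f (ENNReal.ofReal p) (weightedVolume n α)

/-- The involutive automorphism `φ_a` of `𝔹ₙ`:
`φ_a(z) = (a - P_a z - (1 - |a|²)^{1/2} (z - P_a z)) / (1 - ⟨z, a⟩)`, where
`⟨z, a⟩ = ∑ z_k conj(a_k)`, which is `inner ℂ a z` in Mathlib's convention, and
`P_a z = (⟨z, a⟩ / |a|²) a` is the orthogonal projection onto `ℂ a` (so that `P_0 = 0`). -/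
noncomputable def ballInvolution {n : ℕ} (a z : CSpace n) : CSpace n :=
  let P : CSpace n := (inner ℂ a z / (‖a‖ : ℂ) ^ 2) • a
  (1 - inner ℂ a z)⁻¹ • (a - P - ((√(1 - ‖a‖ ^ 2) : ℝ) : ℂ) • (z - P))

/-- The pseudo-hyperbolic metric `ρ(z, w) = |φ_z(w)|` on `𝔹ₙ`. -/
noncomputable def pseudoHyp {n : ℕ} (z w : CSpace n) : ℝ := ‖ballInvolution z w‖

/-- The Bergman metric `β(z, w) = (1/2) log ((1 + |φ_z(w)|) / (1 - |φ_z(w)|))` on `𝔹ₙ`. -/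
noncomputable def bergmanDist {n : ℕ} (z w : CSpace n) : ℝ :=
  1 / 2 * Real.log ((1 + ‖ballInvolution z w‖) / (1 - ‖ballInvolution z w‖))

/-! The involution `φ_z` has real Jacobian `J(z, u) = ((1 - |z|²) / |1 - ⟨u, z⟩|²) ^ (n + 1)`, and
on pseudo-hyperbolic balls of fixed radius `(1 - |z|²)^α J(z, u)` is at most a constant times
`(1 - |u|²)^α J(u, z)`. By a sub-mean-value inequality for `‖f‖ ^ p`, the supremum of `‖f‖ ^ p` over
the pseudo-hyperbolic ball of radius `1/2` about `z` is at most a constant times the integral of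
`‖f ∘ φ_z‖ ^ p` over the ball of radius `3/4`. Since `J(u, ·)` has the same integral over the unit
ball for every `u`, Fubini's theorem puts the supremum of `‖f‖` in `L^p(dv_α)`. The Schwarz lemma
for `f ∘ φ_z` then gives (b), and the bounds `ρ ≤ β`, `ρ(z, w) ≤ |z - w| / (1 - |z|)` and
`ρ(z, w) ≤ |z - w| / (1 - |w|)` give (c) and (d).

Conversely, take two points on a ray at distances `t` and `2t` from the unit sphere. Their `ρ` is at
most `1/2` and their Euclidean distance is `t`, so in each of (c) and (d), with `h(t)` the value of
`‖f‖` at distance `t`, one gets `h(t) ≤ h(2t) + G(t) + G(2t)` with `G` in `L^p(t^α dt)`. As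
`α > -1`, the substitution `t ↦ 2t` multiplies the integral of `h^p t^α` by `2^(-1-α) < 1`, so that
the term `h(2t)` can be absorbed. -/

lemma one_sub_norm_sq_pos {E : Type*} [SeminormedAddCommGroup E] {a : E} (ha : ‖a‖ < 1) :
    0 < 1 - ‖a‖ ^ 2 := by
  nlinarith [norm_nonneg a]

section Involution

variable {n : ℕ}

/-- The number `s_a = (1 - |a|²)^{1/2}` through which the point `a` enters `φ_a`. -/
noncomputable def defect (a : CSpace n) : ℝ := √(1 - ‖a‖ ^ 2)

lemma defect_sq {a : CSpace n} (ha : ‖a‖ < 1) : defect a ^ 2 = 1 - ‖a‖ ^ 2 :=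
  Real.sq_sqrt (one_sub_norm_sq_pos ha).le

lemma defect_pos {a : CSpace n} (ha : ‖a‖ < 1) : 0 < defect a :=
  Real.sqrt_pos.2 (one_sub_norm_sq_pos ha)

lemma one_add_defect_ne_zero (a : CSpace n) : 1 + (defect a : ℂ) ≠ 0 := by
  have : 0 < 1 + defect a := by unfold defect; positivity
  exact_mod_cast this.ne'

lemma inner_self_eq_one_sub_defect_sq {a : CSpace n} (ha : ‖a‖ < 1) :
    inner ℂ a a = 1 - (defect a : ℂ) ^ 2 := by
  rw [inner_self_eq_norm_sq_to_K, ← Complex.ofReal_pow, defect_sq ha]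
  simp

lemma one_sub_norm_le_norm_one_sub_inner {a z : CSpace n} (hz : ‖z‖ ≤ 1) :
    1 - ‖a‖ ≤ ‖1 - inner ℂ a z‖ :=
  calc 1 - ‖a‖ ≤ ‖(1 : ℂ)‖ - ‖inner ℂ a z‖ := by
        rw [norm_one]
        gcongr
        exact (norm_inner_le_norm a z).trans (mul_le_of_le_one_right (norm_nonneg a) hz)
    _ ≤ ‖1 - inner ℂ a z‖ := norm_sub_norm_le _ _

lemma one_sub_inner_ne_zero {a z : CSpace n} (ha : ‖a‖ < 1) (hz : ‖z‖ ≤ 1) :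
    1 - inner ℂ a z ≠ 0 :=
  norm_pos_iff.1 ((sub_pos.2 ha).trans_le (one_sub_norm_le_norm_one_sub_inner hz))

/-- The linear map `z ↦ P_a z + s_a (z - P_a z)`, so that `φ_a(z) = (a - L_a z) / (1 - ⟨z, a⟩)`.
Writing `P_a z` as `⟨z, a⟩ / ((1 + s_a) (1 - s_a))` times `a` removes the division by `|a|²`. -/
noncomputable def involutionLinear (a : CSpace n) : CSpace n →L[ℂ] CSpace n :=
  (defect a : ℂ) • ContinuousLinearMap.id ℂ (CSpace n) +
    (1 + (defect a : ℂ))⁻¹ • (innerSL ℂ a).smulRight a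

lemma involutionLinear_apply (a z : CSpace n) :
    involutionLinear a z = (defect a : ℂ) • z + ((1 + (defect a : ℂ))⁻¹ * inner ℂ a z) • a := by
  simp [involutionLinear, smul_smul]

lemma ballInvolution_eq {a : CSpace n} (ha : ‖a‖ < 1) (z : CSpace n) :
    ballInvolution a z = (1 - inner ℂ a z)⁻¹ • (a - involutionLinear a z) := by
  rcases eq_or_ne a 0 with rfl | h0
  · simp [ballInvolution, involutionLinear_apply, defect]
  have hnorm : (‖a‖ : ℂ) ^ 2 ≠ 0 := by simpa using h0
  have hnorm_sq : (‖a‖ : ℂ) ^ 2 = 1 - (defect a : ℂ) ^ 2 := by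
    rw [← inner_self_eq_one_sub_defect_sq ha, inner_self_eq_norm_sq_to_K]
    rfl
  have hs := one_add_defect_ne_zero a
  have hcoeff : (1 + (defect a : ℂ))⁻¹ * inner ℂ a z =
      (1 - (defect a : ℂ)) * (inner ℂ a z / (‖a‖ : ℂ) ^ 2) := by
    rw [mul_div_assoc', eq_div_iff hnorm, hnorm_sq]
    field_simp
    ring
  rw [ballInvolution, involutionLinear_apply, hcoeff, ← defect]
  module

lemma inner_involutionLinear {a : CSpace n} (ha : ‖a‖ < 1) (z : CSpace n) :
    inner ℂ a (involutionLinear a z) = inner ℂ a z := by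
  have hs := one_add_defect_ne_zero a
  rw [involutionLinear_apply, inner_add_right, inner_smul_right, inner_smul_right,
    inner_self_eq_one_sub_defect_sq ha]
  field_simp
  ring

lemma involutionLinear_self {a : CSpace n} (ha : ‖a‖ < 1) : involutionLinear a a = a := by
  have hs := one_add_defect_ne_zero a
  rw [involutionLinear_apply, inner_self_eq_one_sub_defect_sq ha, ← add_smul]
  convert one_smul ℂ a using 2
  field_simp
  ring

lemma involutionLinear_involutionLinear {a : CSpace n} (ha : ‖a‖ < 1) (z : CSpace n) :
    involutionLinear a (involutionLinear a z) = (defect a : ℂ) ^ 2 • z + inner ℂ a z • a := by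
  have hs := one_add_defect_ne_zero a
  have hinner : inner ℂ a z =
      ((defect a : ℂ) + 1) * ((1 + (defect a : ℂ))⁻¹ * inner ℂ a z) := by
    field_simp
    ring
  conv_lhs => rw [involutionLinear_apply a z]
  rw [map_add, map_smul, map_smul, involutionLinear_self ha, involutionLinear_apply]
  conv_rhs => rw [hinner]
  module

lemma ballInvolution_zero {a : CSpace n} (ha : ‖a‖ < 1) : ballInvolution a 0 = a := by
  simp [ballInvolution_eq ha]

lemma one_sub_inner_ballInvolution {a z : CSpace n} (ha : ‖a‖ < 1) (hz : ‖z‖ ≤ 1) :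
    1 - inner ℂ a (ballInvolution a z) = (defect a : ℂ) ^ 2 / (1 - inner ℂ a z) := by
  have h := one_sub_inner_ne_zero ha hz
  rw [ballInvolution_eq ha, inner_smul_right, inner_sub_right, inner_involutionLinear ha,
    inner_self_eq_one_sub_defect_sq ha]
  field_simp
  ring

lemma ballInvolution_ballInvolution {a z : CSpace n} (ha : ‖a‖ < 1) (hz : ‖z‖ ≤ 1) :
    ballInvolution a (ballInvolution a z) = z := by
  have h := one_sub_inner_ne_zero ha hz
  have hs : (defect a : ℂ) ≠ 0 := by exact_mod_cast (defect_pos ha).ne'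
  have hnumerator :
      a - (1 - inner ℂ a z)⁻¹ • (a - ((defect a : ℂ) ^ 2 • z + inner ℂ a z • a)) =
        ((1 - inner ℂ a z)⁻¹ * (defect a : ℂ) ^ 2) • z := by
    have ha_eq : a = ((1 - inner ℂ a z)⁻¹ * (1 - inner ℂ a z)) • a := by
      rw [inv_mul_cancel₀ h, one_smul]
    nth_rewrite 1 [ha_eq]
    module
  rw [ballInvolution_eq ha (ballInvolution a z), one_sub_inner_ballInvolution ha hz,
    ballInvolution_eq ha z, map_smul, map_sub, involutionLinear_self ha,
    involutionLinear_involutionLinear ha, hnumerator, smul_smul]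
  convert one_smul ℂ z using 2
  field_simp

lemma norm_involutionLinear_sq {a : CSpace n} (ha : ‖a‖ < 1) (z : CSpace n) :
    ‖involutionLinear a z‖ ^ 2 = (1 - ‖a‖ ^ 2) * ‖z‖ ^ 2 + ‖inner ℂ a z‖ ^ 2 := by
  have hs := defect_pos ha
  have hnorm_sq : ‖a‖ ^ 2 = (1 - defect a) * (1 + defect a) := by linarith [defect_sq ha]
  have hcoeff : (1 + (defect a : ℂ))⁻¹ * inner ℂ a z =
      (((1 + defect a)⁻¹ : ℝ) : ℂ) * inner ℂ a z := by
    push_cast; rfl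
  have hcross : (defect a : ℂ) *
      (((1 + defect a)⁻¹ : ℝ) * inner ℂ a z * (starRingEnd ℂ) (inner ℂ a z)) =
        ((defect a * (1 + defect a)⁻¹ * ‖inner ℂ a z‖ ^ 2 : ℝ) : ℂ) := by
    rw [mul_assoc, Complex.mul_conj, Complex.normSq_eq_norm_sq]; push_cast; ring
  rw [involutionLinear_apply, hcoeff, @norm_add_sq ℂ, norm_smul, norm_smul, norm_mul,
    inner_smul_left, inner_smul_right, Complex.conj_ofReal, Complex.norm_real, Complex.norm_real,
    ← inner_conj_symm z a, hcross, RCLike.re_eq_complex_re, Complex.ofReal_re,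
    Real.norm_of_nonneg hs.le, Real.norm_of_nonneg (by positivity), ← defect_sq ha]
  simp only [mul_pow, hnorm_sq]
  field_simp
  ring

lemma one_sub_norm_ballInvolution_sq {a z : CSpace n} (ha : ‖a‖ < 1) (hz : ‖z‖ ≤ 1) :
    1 - ‖ballInvolution a z‖ ^ 2 =
      (1 - ‖a‖ ^ 2) * (1 - ‖z‖ ^ 2) / ‖1 - inner ℂ a z‖ ^ 2 := by
  have h := norm_pos_iff.2 (one_sub_inner_ne_zero ha hz)
  rw [ballInvolution_eq ha, norm_smul, norm_inv, mul_pow, @norm_sub_sq ℂ,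
    norm_involutionLinear_sq ha, inner_involutionLinear ha]
  field_simp
  rw [@norm_sub_sq_real ℂ, Complex.inner]
  simp only [norm_one, one_pow, map_one, mul_one, RCLike.re_to_complex]
  ring

lemma norm_ballInvolution_lt_one {a z : CSpace n} (ha : ‖a‖ < 1) (hz : ‖z‖ < 1) :
    ‖ballInvolution a z‖ < 1 := by
  have hinner := norm_pos_iff.2 (one_sub_inner_ne_zero ha hz.le)
  have hpos : 0 < 1 - ‖ballInvolution a z‖ ^ 2 := by
    rw [one_sub_norm_ballInvolution_sq ha hz.le]
    have := one_sub_norm_sq_pos ha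
    have := one_sub_norm_sq_pos hz
    positivity
  nlinarith [norm_nonneg (ballInvolution a z)]

lemma norm_ballInvolution_le {a z : CSpace n} (ha : ‖a‖ < 1) (hz : ‖z‖ ≤ 1) :
    ‖ballInvolution a z‖ ≤ ‖a - z‖ / ‖1 - inner ℂ a z‖ := by
  have h := norm_pos_iff.2 (one_sub_inner_ne_zero ha hz)
  have hball := one_sub_norm_ballInvolution_sq ha hz
  have hinner : ‖1 - inner ℂ a z‖ ^ 2 = 1 - 2 * (inner ℂ a z).re + ‖inner ℂ a z‖ ^ 2 := by
    rw [@norm_sub_sq_real ℂ, Complex.inner]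
    simp
  have hsub : ‖a - z‖ ^ 2 = ‖a‖ ^ 2 - 2 * (inner ℂ a z).re + ‖z‖ ^ 2 := by
    rw [@norm_sub_sq ℂ]
    simp
  have hcs : ‖inner ℂ a z‖ ^ 2 ≤ ‖a‖ ^ 2 * ‖z‖ ^ 2 := by
    rw [← mul_pow]
    gcongr
    exact norm_inner_le_norm a z
  rw [eq_div_iff (by positivity)] at hball
  rw [le_div_iff₀ h]
  refine le_of_sq_le_sq ?_ (norm_nonneg _)
  rw [mul_pow, hsub]
  nlinarith

lemma pseudoHyp_nonneg (z w : CSpace n) : 0 ≤ pseudoHyp z w := norm_nonneg _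

lemma bijOn_ballInvolution {a : CSpace n} (ha : ‖a‖ < 1) :
    Set.BijOn (ballInvolution a) (ball 0 1) (ball 0 1) := by
  have hmaps : Set.MapsTo (ballInvolution a) (ball 0 1) (ball 0 1) := fun z hz => by
    rw [mem_ball_zero_iff] at hz ⊢
    exact norm_ballInvolution_lt_one ha hz
  have hinv : Set.LeftInvOn (ballInvolution a) (ballInvolution a) (ball 0 1) := fun z hz =>
    ballInvolution_ballInvolution ha (mem_ball_zero_iff.1 hz).le
  exact ⟨hmaps, hinv.injOn, fun z hz => ⟨_, hmaps hz, hinv hz⟩⟩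

/-- The complex derivative of `ballInvolution a` at `z`. -/
noncomputable def involutionDeriv (a z : CSpace n) : CSpace n →L[ℂ] CSpace n :=
  (1 - inner ℂ a z)⁻¹ • ((innerSL ℂ a).smulRight (ballInvolution a z) - involutionLinear a)

lemma hasFDerivAt_ballInvolution {a z : CSpace n} (ha : ‖a‖ < 1) (hz : ‖z‖ ≤ 1) :
    HasFDerivAt (ballInvolution a) (involutionDeriv a z) z := by
  have h := one_sub_inner_ne_zero ha hz
  have hdenominator : HasFDerivAt (fun z => 1 - innerSL ℂ a z) (-(innerSL ℂ a)) z :=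
    (innerSL ℂ a).hasFDerivAt.const_sub 1
  have hnumerator : HasFDerivAt (fun z => a - involutionLinear a z) (-(involutionLinear a)) z :=
    (involutionLinear a).hasFDerivAt.const_sub a
  have hquotient :=
    ((hasDerivAt_inv (by simpa using h)).comp_hasFDerivAt z hdenominator).smul hnumerator
  rw [show ballInvolution a = fun z => (1 - inner ℂ a z)⁻¹ • (a - involutionLinear a z) from
    funext (ballInvolution_eq ha)]
  refine hquotient.congr_fderiv ?_
  ext1 v
  simp only [involutionDeriv, ballInvolution_eq ha, innerSL_apply_apply, add_apply, smul_apply,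
    neg_apply, ContinuousLinearMap.smulRight_apply, sub_apply, smul_neg, neg_smul, neg_neg,
    smul_smul, smul_sub, smul_eq_mul, Function.comp_apply, ← inv_pow]
  module

lemma det_smul_id_add_smulRight {K V : Type*} [Field K] [AddCommGroup V] [Module K V]
    [FiniteDimensional K V] {c : K} (hc : c ≠ 0) (ℓ : V →ₗ[K] K) (v : V) :
    LinearMap.det (c • LinearMap.id + ℓ.smulRight v) =
      c ^ Module.finrank K V * (1 + ℓ v / c) := by
  have htransvection :
      c • LinearMap.id + ℓ.smulRight v = c • LinearMap.transvection ℓ (c⁻¹ • v) := by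
    ext1 w
    simp [LinearMap.transvection, smul_smul, mul_comm c, hc]
  rw [htransvection, LinearMap.det_smul, LinearMap.transvection.det]
  simp [div_eq_inv_mul]

lemma det_involutionDeriv {a z : CSpace n} (ha : ‖a‖ < 1) (hz : ‖z‖ ≤ 1) :
    (involutionDeriv a z).det =
      (-defect a / (1 - inner ℂ a z)) ^ n * (defect a / (1 - inner ℂ a z)) := by
  have h := one_sub_inner_ne_zero ha hz
  have hs : (defect a : ℂ) ≠ 0 := by exact_mod_cast (defect_pos ha).ne'
  have h1s := one_add_defect_ne_zero a
  have hrank_one : ((involutionDeriv a z : CSpace n →L[ℂ] CSpace n) : CSpace n →ₗ[ℂ] CSpace n) =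
      (1 - inner ℂ a z)⁻¹ • ((-(defect a : ℂ)) • LinearMap.id +
        (innerSL ℂ a : CSpace n →ₗ[ℂ] ℂ).smulRight
          (ballInvolution a z - (1 + (defect a : ℂ))⁻¹ • a)) := by
    ext1 v
    simp only [involutionDeriv, ContinuousLinearMap.coe_coe, smul_apply, sub_apply,
      ContinuousLinearMap.smulRight_apply, innerSL_apply_apply, involutionLinear_apply,
      LinearMap.smul_apply, LinearMap.add_apply, LinearMap.smulRight_apply, LinearMap.id_apply]
    module
  have hinner : inner ℂ a (ballInvolution a z) = 1 - (defect a : ℂ) ^ 2 / (1 - inner ℂ a z) := by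
    rw [← one_sub_inner_ballInvolution ha hz, sub_sub_cancel]
  rw [ContinuousLinearMap.det, hrank_one, LinearMap.det_smul,
    det_smul_id_add_smulRight (neg_ne_zero.2 hs), ContinuousLinearMap.coe_coe,
    innerSL_apply_apply, inner_sub_right, inner_smul_right, inner_self_eq_one_sub_defect_sq ha,
    hinner, finrank_euclideanSpace_fin, div_pow, inv_pow]
  field_simp
  ring

lemma abs_det_involutionDeriv {a z : CSpace n} (ha : ‖a‖ < 1) (hz : ‖z‖ ≤ 1) :
    |((involutionDeriv a z).restrictScalars ℝ).det| =
      ((1 - ‖a‖ ^ 2) / ‖1 - inner ℂ a z‖ ^ 2) ^ (n + 1) := by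
  have hreal : ((involutionDeriv a z).restrictScalars ℝ).det =
      Complex.normSq (involutionDeriv a z).det := by
    rw [← Algebra.norm_complex_apply, ContinuousLinearMap.det, ContinuousLinearMap.det,
      ← LinearMap.det_restrictScalars]
    rfl
  rw [hreal, abs_of_nonneg (Complex.normSq_nonneg _), Complex.normSq_eq_norm_sq,
    det_involutionDeriv ha hz, norm_mul, norm_pow, norm_div, norm_div, norm_neg, Complex.norm_real,
    Real.norm_of_nonneg (defect_pos ha).le, ← pow_succ, ← pow_mul, mul_comm, pow_mul, div_pow,
    defect_sq ha]

end Involution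

lemma rpow_mul_le_half_add {p : ℝ} (hp : 0 < p) {D m x : ENNReal} (h : x ^ p ≤ D * m ^ p) :
    m ^ p * x ≤ m ^ p * (m / 2) + 2 ^ p * D ^ p⁻¹ * (m * x ^ p) := by
  rcases le_total x (m / 2) with hx | hx
  · exact le_add_right (by gcongr)
  have hm : m ^ p ≤ 2 ^ p * x ^ p := by
    rw [← ENNReal.mul_rpow_of_nonneg _ _ hp.le]
    gcongr
    exact (ENNReal.div_le_iff' two_ne_zero ENNReal.ofNat_ne_top).1 hx
  have hx' : x ≤ D ^ p⁻¹ * m := by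
    rw [← ENNReal.rpow_le_rpow_iff hp, ENNReal.mul_rpow_of_nonneg _ _ hp.le,
      ENNReal.rpow_inv_rpow hp.ne']
    exact h
  calc m ^ p * x ≤ 2 ^ p * x ^ p * (D ^ p⁻¹ * m) := by gcongr
    _ = 2 ^ p * D ^ p⁻¹ * (m * x ^ p) := by ring
    _ ≤ _ := le_add_self

lemma exists_ball_forall_le_two_pow_mul {X : Type*} [PseudoMetricSpace X] [ProperSpace X]
    {φ : X → ℝ} {z : X} {r : ℝ} (hr : 0 < r) (hφ : ContinuousOn φ (closedBall z r))
    (hz : 0 < φ z) (d : ℕ) :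
    ∃ w, ∃ δ > 0, closedBall w δ ⊆ ball z r ∧ r ^ d * φ z ≤ (2 * δ) ^ d * φ w ∧
      ∀ u ∈ ball w δ, φ u ≤ 2 ^ (d + 1) * φ w := by
  -- The weight vanishes on the sphere, so the maximum point `w` is interior; on the ball about `w`
  -- reaching half way to the sphere it drops at most by a factor `2 ^ (d + 1)`.
  obtain ⟨w, hw, hmax⟩ := (isCompact_closedBall z r).exists_isMaxOn
    (f := fun u => (r - dist u z) ^ (d + 1) * φ u) ⟨z, mem_closedBall_self hr.le⟩
    ((by fun_prop : Continuous fun u => (r - dist u z) ^ (d + 1)).continuousOn.mul hφ)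
  have hzw : r ^ (d + 1) * φ z ≤ (r - dist w z) ^ (d + 1) * φ w := by
    simpa using hmax (mem_closedBall_self hr.le)
  have hpos : 0 < (r - dist w z) ^ (d + 1) * φ w := hzw.trans_lt' (by positivity)
  have hdist : 0 < r - dist w z := by
    refine lt_of_le_of_ne (sub_nonneg.2 hw) fun h => ?_
    simp [← h] at hpos
  have hw_pos : 0 < φ w := pos_of_mul_pos_right hpos (by positivity)
  obtain ⟨δ, hδ⟩ : ∃ δ, r - dist w z = 2 * δ := ⟨(r - dist w z) / 2, by ring⟩
  have hδ_pos : 0 < δ := by linarith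
  have hball : closedBall w δ ⊆ ball z r := closedBall_subset_ball' (by linarith)
  refine ⟨w, δ, hδ_pos, hball, ?_, fun u hu => ?_⟩
  · have hδr : 2 * δ ≤ r := by linarith [dist_nonneg (x := w) (y := z)]
    refine le_of_mul_le_mul_left ?_ hr
    calc r * (r ^ d * φ z) = r ^ (d + 1) * φ z := by ring
      _ ≤ (2 * δ) ^ (d + 1) * φ w := hδ ▸ hzw
      _ = 2 * δ * ((2 * δ) ^ d * φ w) := by ring
      _ ≤ r * ((2 * δ) ^ d * φ w) := by gcongr
  · have hu_max := hmax (ball_subset_closedBall (hball (ball_subset_closedBall hu)))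
    have hδu : δ ≤ r - dist u z := by
      linarith [dist_triangle u w z, mem_ball.1 hu]
    refine le_of_mul_le_mul_left ?_ (pow_pos hδ_pos (d + 1))
    rcases le_total (φ u) 0 with hu0 | hu0
    · exact (mul_nonpos_of_nonneg_of_nonpos (by positivity) hu0).trans (by positivity)
    calc δ ^ (d + 1) * φ u ≤ (r - dist u z) ^ (d + 1) * φ u := by gcongr
      _ ≤ (2 * δ) ^ (d + 1) * φ w := hδ ▸ hu_max
      _ = δ ^ (d + 1) * (2 ^ (d + 1) * φ w) := by rw [mul_pow]; ring

section SubMean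

variable {E F : Type*} [NormedAddCommGroup E] [NormedSpace ℂ E]
  [NormedAddCommGroup F] [NormedSpace ℂ F]

lemma norm_sub_le_four_mul_of_bounded {f : E → F} (hf : DifferentiableOn ℂ f (ball 0 1)) {A : ℝ}
    (hA : ∀ u : E, ‖u‖ ≤ 1 / 2 → ‖f u‖ ≤ A) {z : E} (hz : ‖z‖ < 1 / 2) :
    ‖f z - f 0‖ ≤ 4 * A * ‖z‖ := by
  have hmaps : Set.MapsTo f (ball 0 (1 / 2)) (closedBall (f 0) (2 * A)) := fun u hu => by
    rw [mem_closedBall_iff_norm]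
    linarith [norm_sub_le (f u) (f 0), hA u (mem_ball_zero_iff.1 hu).le, hA 0 (by simp)]
  have hschwarz := Complex.dist_le_div_mul_dist_of_mapsTo_ball
    (hf.mono (ball_subset_ball (by norm_num))) hmaps (mem_ball_zero_iff.2 hz)
  rw [dist_eq_norm, dist_zero_right] at hschwarz
  linarith

variable [CompleteSpace F]

lemma enorm_mul_two_pi_le_lintegral_circleMap {g : ℂ → F} {c : ℂ} {R : ℝ}
    (hg : DiffContOnCl ℂ g (ball c |R|)) :
    ‖g c‖ₑ * ENNReal.ofReal (2 * Real.pi) ≤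
      ∫⁻ θ in Set.Ioc 0 (2 * Real.pi), ‖g (circleMap c R θ)‖ₑ := by
  have hmean := hg.circleAverage
  rw [Real.circleAverage_def, inv_smul_eq_iff₀ (by positivity),
    intervalIntegral.integral_of_le (by positivity)] at hmean
  calc ‖g c‖ₑ * ENNReal.ofReal (2 * Real.pi) = ‖(2 * Real.pi) • g c‖ₑ := by
        rw [enorm_smul, Real.enorm_eq_ofReal (by positivity), mul_comm]
    _ ≤ ∫⁻ θ in Set.Ioc 0 (2 * Real.pi), ‖g (circleMap c R θ)‖ₑ := by
        rw [← hmean]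
        exact enorm_integral_le_lintegral_enorm _

lemma enorm_mul_two_pi_le_lintegral_add_smul {f : E → F} {z u : E}
    (hf : DifferentiableOn ℂ f (closedBall z ‖u‖)) :
    ‖f z‖ₑ * ENNReal.ofReal (2 * Real.pi) ≤
      ∫⁻ θ in Set.Ioc 0 (2 * Real.pi), ‖f (z + circleMap 0 1 θ • u)‖ₑ := by
  have hslice : DifferentiableOn ℂ (fun c : ℂ => f (z + c • u)) (closedBall 0 1) := by
    refine hf.comp (by fun_prop) fun c hc => ?_
    rw [mem_closedBall_iff_norm, add_sub_cancel_left, norm_smul]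
    exact mul_le_of_le_one_left (norm_nonneg u) (mem_closedBall_zero_iff.1 hc)
  simpa using enorm_mul_two_pi_le_lintegral_circleMap (c := 0) (R := 1)
    (hslice.diffContOnCl_ball (by rw [abs_one]))

variable [FiniteDimensional ℂ E] [MeasurableSpace E] [BorelSpace E]
  (μ : Measure E) [μ.IsAddHaarMeasure]

lemma measurePreserving_const_smul {c : ℂ} (hc : ‖c‖ = 1) :
    MeasurePreserving (fun u : E => c • u) μ μ := by
  have hc0 : c ≠ 0 := norm_ne_zero_iff.1 (hc ▸ one_ne_zero)
  let rotation : E ≃ₗ[ℝ] E := (LinearEquiv.smulOfNeZero ℂ E c hc0).restrictScalars ℝ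
  have hmap := μ.map_linearMap_addHaar_eq_smul_addHaar rotation.isUnit_det'.ne_zero
  have hball : μ.map (rotation : E →ₗ[ℝ] E) (ball 0 1) = μ (ball 0 1) := by
    have hmeas : Measurable (rotation : E →ₗ[ℝ] E) := (continuous_const_smul c).measurable
    rw [Measure.map_apply hmeas measurableSet_ball]
    congr 1
    ext u
    simp [rotation, norm_smul, hc]
  have hmul := congr($hmap (ball 0 1))
  rw [hball, Measure.smul_apply, smul_eq_mul, eq_comm] at hmul
  have hdet := (ENNReal.mul_eq_right (measure_ball_pos μ 0 one_pos).ne'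
    measure_ball_lt_top.ne).1 hmul
  rw [hdet, one_smul] at hmap
  exact ⟨by fun_prop, hmap⟩

lemma setLIntegral_ball_comp_add_smul (g : E → ENNReal) (z : E) (r : ℝ) {c : ℂ} (hc : ‖c‖ = 1) :
    ∫⁻ u in ball 0 r, g (z + c • u) ∂μ = ∫⁻ u in ball z r, g u ∂μ := by
  have hc0 : c ≠ 0 := norm_ne_zero_iff.1 (hc ▸ one_ne_zero)
  have hemb : MeasurableEmbedding fun u : E => z + c • u :=
    (Homeomorph.addLeft z).measurableEmbedding.comp
      (Homeomorph.smulOfNeZero c hc0).measurableEmbedding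
  have hpreserving : MeasurePreserving (fun u : E => z + c • u) μ μ :=
    (measurePreserving_add_left μ z).comp (measurePreserving_const_smul μ hc)
  rw [← hpreserving.setLIntegral_comp_preimage_emb hemb g (ball z r)]
  congr 2
  ext u
  simp [dist_eq_norm, norm_smul, hc]

lemma enorm_mul_measure_ball_le_setLIntegral {f : E → F} {z : E} {r : ℝ}
    (hf : DifferentiableOn ℂ f (closedBall z r)) :
    ‖f z‖ₑ * μ (ball z r) ≤ ∫⁻ u in ball z r, ‖f u‖ₑ ∂μ := by
  have hmeas : AEMeasurable (Function.uncurry fun (u : E) (θ : ℝ) =>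
      ‖f (z + circleMap 0 1 θ • u)‖ₑ) ((μ.restrict (ball 0 r)).prod
        (volume.restrict (Set.Ioc 0 (2 * Real.pi)))) := by
    rw [Measure.prod_restrict]
    refine ContinuousOn.aemeasurable ?_ (measurableSet_ball.prod measurableSet_Ioc)
    have := continuous_circleMap 0 1
    refine (hf.continuousOn.comp (by fun_prop) fun x hx => ?_).enorm
    simpa [norm_smul] using (mem_ball_zero_iff.1 hx.1).le
  have htwo_pi : ENNReal.ofReal (2 * Real.pi) ≠ 0 := by simp [Real.pi_pos]
  refine (ENNReal.mul_le_mul_iff_left htwo_pi ENNReal.ofReal_ne_top).1 ?_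
  calc ‖f z‖ₑ * μ (ball z r) * ENNReal.ofReal (2 * Real.pi)
      = ∫⁻ _ in ball (0 : E) r, ‖f z‖ₑ * ENNReal.ofReal (2 * Real.pi) ∂μ := by
        rw [setLIntegral_const, Measure.addHaar_ball_center, mul_right_comm]
    _ ≤ ∫⁻ u in ball (0 : E) r, (∫⁻ θ in Set.Ioc 0 (2 * Real.pi),
          ‖f (z + circleMap 0 1 θ • u)‖ₑ) ∂μ :=
        setLIntegral_mono' measurableSet_ball fun u hu =>
          enorm_mul_two_pi_le_lintegral_add_smul
            (hf.mono (closedBall_subset_closedBall (mem_ball_zero_iff.1 hu).le))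
    _ = ∫⁻ θ in Set.Ioc 0 (2 * Real.pi), ∫⁻ u in ball (0 : E) r,
          ‖f (z + circleMap 0 1 θ • u)‖ₑ ∂μ := lintegral_lintegral_swap hmeas
    _ = ∫⁻ _ in Set.Ioc 0 (2 * Real.pi), ∫⁻ u in ball z r, ‖f u‖ₑ ∂μ :=
        lintegral_congr fun θ =>
          setLIntegral_ball_comp_add_smul μ (fun u => ‖f u‖ₑ) z r (by simp)
    _ = (∫⁻ u in ball z r, ‖f u‖ₑ ∂μ) * ENNReal.ofReal (2 * Real.pi) := by simp

/- For `p < 1` the mean value inequality for `‖f‖ ^ p` does not follow from the one for `‖f‖` by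
Hölder. Instead multiply the latter by `m ^ p`, where `m = ‖f z‖`: the part with `‖f u‖ ≤ m / 2`
is absorbed by the left side, and elsewhere the bound `D` compares `m ^ p * ‖f u‖` with
`m * ‖f u‖ ^ p`. -/
lemma enorm_rpow_mul_measure_ball_le_of_rpow_le {p : ℝ} (hp : 0 < p) {f : E → F} {z : E}
    {r : ℝ} (hf : DifferentiableOn ℂ f (closedBall z r)) {D : ENNReal}
    (hD : ∀ u ∈ ball z r, ‖f u‖ₑ ^ p ≤ D * ‖f z‖ₑ ^ p) :
    ‖f z‖ₑ ^ p * μ (ball z r) ≤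
      2 * (2 ^ p * D ^ p⁻¹) * ∫⁻ u in ball z r, ‖f u‖ₑ ^ p ∂μ := by
  rcases eq_or_ne (f z) 0 with h0 | h0
  · simp [h0, hp]
  set m := ‖f z‖ₑ with hm
  have hm0 : m ≠ 0 := by simpa [hm] using h0
  set c := 2 ^ p * D ^ p⁻¹
  set I := ∫⁻ u in ball z r, ‖f u‖ₑ ^ p ∂μ
  set X := m ^ p * (m / 2) * μ (ball z r)
  have hX : X ≠ ⊤ := by
    have hm_top : m ≠ ⊤ := enorm_ne_top
    exact ENNReal.mul_ne_top (ENNReal.mul_ne_top (ENNReal.rpow_ne_top_of_nonneg hp.le hm_top)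
      (ENNReal.div_ne_top hm_top two_ne_zero)) measure_ball_lt_top.ne
  have hXX : m ^ p * (m * μ (ball z r)) = X + X :=
    calc m ^ p * (m * μ (ball z r)) = m ^ p * ((m / 2 + m / 2) * μ (ball z r)) := by
          rw [ENNReal.add_halves]
      _ = X + X := by ring
  have hcontinuous : ContinuousOn (fun u => ‖f u‖ₑ) (ball z r) :=
    (hf.continuousOn.mono ball_subset_closedBall).enorm
  have hmean : X + X ≤ X + c * (m * I) :=
    calc X + X = m ^ p * (m * μ (ball z r)) := hXX.symm
      _ ≤ m ^ p * ∫⁻ u in ball z r, ‖f u‖ₑ ∂μ := by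
          gcongr
          exact enorm_mul_measure_ball_le_setLIntegral μ hf
      _ ≤ ∫⁻ u in ball z r, m ^ p * ‖f u‖ₑ ∂μ := lintegral_const_mul_le _ _
      _ ≤ ∫⁻ u in ball z r, (m ^ p * (m / 2) + c * m * ‖f u‖ₑ ^ p) ∂μ :=
          setLIntegral_mono' measurableSet_ball fun u hu =>
            (rpow_mul_le_half_add hp (hD u hu)).trans_eq (by ring)
      _ = X + c * m * I := by
          rw [lintegral_add_left measurable_const, setLIntegral_const,
            lintegral_const_mul'' _ ((hcontinuous.aemeasurable measurableSet_ball).pow_const p)]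
      _ = X + c * (m * I) := by ring
  refine (ENNReal.mul_le_mul_iff_right hm0 enorm_ne_top).1 ?_
  calc m * (m ^ p * μ (ball z r)) = X + X := by rw [← hXX]; ring
    _ ≤ c * (m * I) + c * (m * I) := by
        have := ENNReal.le_of_add_le_add_left hX hmean
        gcongr
    _ = m * (2 * c * I) := by ring

lemma exists_enorm_rpow_mul_measure_ball_le {p : ℝ} (hp : 0 < p) :
    ∃ C ≠ ⊤, ∀ (f : E → F) (z : E) (r : ℝ), 0 < r → DifferentiableOn ℂ f (closedBall z r) →
      ‖f z‖ₑ ^ p * μ (ball z r) ≤ C * ∫⁻ u in ball z r, ‖f u‖ₑ ^ p ∂μ := by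
  set d := Module.finrank ℝ E
  set D : ENNReal := 2 ^ (d + 1) with hD
  set c : ENNReal := 2 * (2 ^ p * D ^ p⁻¹)
  have hc_top : c ≠ ⊤ := by finiteness
  refine ⟨2 ^ d * c, by finiteness, fun f z r hr hf => ?_⟩
  rcases eq_or_ne (f z) 0 with h0 | h0
  · simp [h0, hp]
  have henorm (u : E) : ENNReal.ofReal (‖f u‖ ^ p) = ‖f u‖ₑ ^ p := by
    rw [← ENNReal.ofReal_rpow_of_nonneg (norm_nonneg _) hp.le, ofReal_norm]
  obtain ⟨w, δ, hδ, hball, hzw, hw⟩ := exists_ball_forall_le_two_pow_mul (d := d) hr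
    (hf.continuousOn.norm.rpow_const fun _ _ => Or.inr hp.le)
    (Real.rpow_pos_of_pos (norm_pos_iff.2 h0) p)
  have hlocal : ‖f w‖ₑ ^ p * μ (ball w δ) ≤ c * ∫⁻ u in ball w δ, ‖f u‖ₑ ^ p ∂μ := by
    refine enorm_rpow_mul_measure_ball_le_of_rpow_le μ hp
      (hf.mono (hball.trans ball_subset_closedBall)) fun u hu => ?_
    simpa [henorm, hD, ENNReal.ofReal_mul, ENNReal.ofReal_pow] using
      ENNReal.ofReal_le_ofReal (hw u hu)
  have hradii : ENNReal.ofReal (r ^ d) * ‖f z‖ₑ ^ p ≤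
      2 ^ d * (ENNReal.ofReal (δ ^ d) * ‖f w‖ₑ ^ p) := by
    rw [mul_pow, mul_assoc] at hzw
    simpa [henorm, ENNReal.ofReal_mul, hr.le, hδ.le] using ENNReal.ofReal_le_ofReal hzw
  calc ‖f z‖ₑ ^ p * μ (ball z r)
      = ENNReal.ofReal (r ^ d) * ‖f z‖ₑ ^ p * μ (ball 0 1) := by
        rw [μ.addHaar_ball_of_pos z hr]; ring
    _ ≤ 2 ^ d * (ENNReal.ofReal (δ ^ d) * ‖f w‖ₑ ^ p) * μ (ball 0 1) := by gcongr
    _ = 2 ^ d * (‖f w‖ₑ ^ p * μ (ball w δ)) := by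
        rw [μ.addHaar_ball_of_pos w hδ]; ring
    _ ≤ 2 ^ d * (c * ∫⁻ u in ball z r, ‖f u‖ₑ ^ p ∂μ) := by
        gcongr 2 ^ d * ?_
        refine hlocal.trans ?_
        gcongr c * ?_
        exact lintegral_mono_set (ball_subset_closedBall.trans hball)
    _ = 2 ^ d * c * ∫⁻ u in ball z r, ‖f u‖ₑ ^ p ∂μ := by ring

end SubMean

section Hardy

open scoped ENNReal

lemma add_rpow_le_add_mul_rpow {p : ℝ} (hp : 0 ≤ p) {ε : ℝ≥0∞} (hε : ε ≠ 0) (hε' : ε ≠ ∞)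
    (a b : ℝ≥0∞) : (a + b) ^ p ≤ ((1 + ε) * a) ^ p + ((1 + ε⁻¹) * b) ^ p := by
  rcases le_total b (ε * a) with h | h
  · refine le_add_right ?_
    gcongr
    rw [add_mul, one_mul]
    gcongr
  · refine le_add_left ?_
    gcongr
    rw [add_mul, one_mul, add_comm, mul_comm, ← div_eq_mul_inv]
    gcongr
    rwa [ENNReal.le_div_iff_mul_le (.inl hε) (.inl hε'), mul_comm]

lemma le_mul_inv_one_sub_of_le_add_mul {a : ℕ → ℝ≥0∞} {A θ : ℝ≥0∞} (hθ : θ < 1) (h0 : a 0 = 0)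
    (hsucc : ∀ N, a (N + 1) ≤ θ * a N + A) (N : ℕ) : a N ≤ A * (1 - θ)⁻¹ := by
  induction N with
  | zero => simp [h0]
  | succ N ih =>
    have hθ0 : 1 - θ ≠ 0 := (tsub_pos_of_lt hθ).ne'
    have hcancel : (1 - θ) * (1 - θ)⁻¹ = 1 := ENNReal.mul_inv_cancel hθ0 (by finiteness)
    calc a (N + 1) ≤ θ * (A * (1 - θ)⁻¹) + A := (hsucc N).trans (by gcongr)
      _ = A * (θ * (1 - θ)⁻¹) + A * ((1 - θ) * (1 - θ)⁻¹) := by rw [hcancel]; ring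
      _ = A * (1 - θ)⁻¹ := by rw [← mul_add, ← add_mul, add_tsub_cancel_of_le hθ.le, one_mul]

lemma lintegral_Ioo_comp_mul_left (H : ℝ → ℝ≥0∞) {K : ℝ} (hK : 0 < K) (a b : ℝ) :
    ∫⁻ t in Set.Ioo (a / K) (b / K), H (K * t) =
      ENNReal.ofReal K⁻¹ * ∫⁻ t in Set.Ioo a b, H t := by
  have hemb : MeasurableEmbedding (K * · : ℝ → ℝ) :=
    (Homeomorph.mulLeft₀ K hK.ne').measurableEmbedding
  have hpre : (K * · : ℝ → ℝ) ⁻¹' Set.Ioo a b = Set.Ioo (a / K) (b / K) := by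
    ext t
    simp [div_lt_iff₀ hK, lt_div_iff₀ hK, mul_comm]
  rw [← hpre, ← hemb.lintegral_map, ← hemb.restrict_map, Real.map_volume_mul_left hK.ne',
    Measure.restrict_smul, lintegral_smul_measure, abs_of_pos (inv_pos.2 hK), smul_eq_mul]

lemma lintegral_Ioo_comp_mul_left_mul_rpow (H : ℝ → ℝ≥0∞) (α : ℝ) {K a b : ℝ} (hK : 0 < K)
    (ha : 0 ≤ a) :
    ∫⁻ t in Set.Ioo (a / K) (b / K), H (K * t) * ENNReal.ofReal (t ^ α) =
      ENNReal.ofReal (K ^ (-(1 + α))) * ∫⁻ t in Set.Ioo a b, H t * ENNReal.ofReal (t ^ α) := by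
  have hweight : ∀ t ∈ Set.Ioo (a / K) (b / K), H (K * t) * ENNReal.ofReal (t ^ α) =
      ENNReal.ofReal (K ^ (-α)) * (H (K * t) * ENNReal.ofReal ((K * t) ^ α)) := fun t ht => by
    have ht0 : 0 ≤ t := (div_nonneg ha hK.le).trans ht.1.le
    rw [mul_left_comm, ← ENNReal.ofReal_mul (by positivity), Real.mul_rpow hK.le ht0, ← mul_assoc,
      ← Real.rpow_add hK, neg_add_cancel, Real.rpow_zero, one_mul]
  rw [setLIntegral_congr_fun measurableSet_Ioo hweight,
    lintegral_const_mul' _ _ ENNReal.ofReal_ne_top,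
    lintegral_Ioo_comp_mul_left (fun t => H t * ENNReal.ofReal (t ^ α)) hK, ← mul_assoc,
    ← ENNReal.ofReal_mul (by positivity), ← Real.rpow_neg_one, ← Real.rpow_add hK]
  congr 4
  ring

lemma lintegral_Ico_rpow_lt_top {a : ℝ} (ha : 0 < a) (b α : ℝ) :
    ∫⁻ t in Set.Ico a b, ENNReal.ofReal (t ^ α) < ∞ := by
  have hintegrable : IntegrableOn (fun t : ℝ => t ^ α) (Set.Icc a b) :=
    (continuousOn_id.rpow_const fun t ht =>
      Or.inl (ha.trans_le ht.1).ne').integrableOn_compact isCompact_Icc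
  exact (hintegrable.mono_set Set.Ico_subset_Icc_self).lintegral_lt_top

lemma exists_rpow_mul_rpow_lt_one {p K γ : ℝ} (hp : 0 < p) (hK : 1 < K) (hγ : 0 < γ) :
    ∃ ε : ℝ≥0∞, ε ≠ 0 ∧ ε ≠ ∞ ∧ (1 + ε) ^ p * ENNReal.ofReal (K ^ (-γ)) < 1 := by
  have hK0 : 0 < K := one_pos.trans hK
  have hc : 1 < K ^ (γ / (2 * p)) := Real.one_lt_rpow hK (by positivity)
  refine ⟨ENNReal.ofReal (K ^ (γ / (2 * p)) - 1), by simpa using hc, ENNReal.ofReal_ne_top, ?_⟩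
  rw [← ENNReal.ofReal_one, ← ENNReal.ofReal_add zero_le_one (by linarith), add_sub_cancel,
    ENNReal.ofReal_rpow_of_nonneg (by positivity) hp.le, ← ENNReal.ofReal_mul (by positivity),
    ← Real.rpow_mul hK0.le, ← Real.rpow_add hK0]
  refine (ENNReal.ofReal_lt_ofReal_iff one_pos).2 (Real.rpow_lt_one_of_one_lt_of_neg hK ?_)
  have : γ / (2 * p) * p = γ / 2 := by field_simp
  linarith

lemma lintegral_Ioo_rpow_mul_rpow_le_add {h g : ℝ → ℝ≥0∞} {M ε : ℝ≥0∞} {p α K a s : ℝ}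
    (hp : 0 ≤ p) (hK : 0 < K) (ha : 0 ≤ a) (hε : ε ≠ 0) (hε' : ε ≠ ∞) (hg : Measurable g)
    (hle : ∀ t ∈ Set.Ioo (a / K) (s / K), h t ≤ h (K * t) + g t)
    (hM : ∀ t ∈ Set.Ico (s / K) s, h t ≤ M) :
    ∫⁻ t in Set.Ioo (a / K) s, h t ^ p * ENNReal.ofReal (t ^ α) ≤
      (1 + ε) ^ p * ENNReal.ofReal (K ^ (-(1 + α))) *
          (∫⁻ t in Set.Ioo a s, h t ^ p * ENNReal.ofReal (t ^ α)) +
        (1 + ε⁻¹) ^ p * (∫⁻ t in Set.Ioo (a / K) (s / K), g t ^ p * ENNReal.ofReal (t ^ α)) +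
        M ^ p * ∫⁻ t in Set.Ico (s / K) s, ENNReal.ofReal (t ^ α) := by
  have hlow : ∫⁻ t in Set.Ioo (a / K) (s / K), h t ^ p * ENNReal.ofReal (t ^ α) ≤
      ∫⁻ t in Set.Ioo (a / K) (s / K), ((1 + ε) ^ p * (h (K * t) ^ p * ENNReal.ofReal (t ^ α)) +
        (1 + ε⁻¹) ^ p * (g t ^ p * ENNReal.ofReal (t ^ α))) :=
    setLIntegral_mono' measurableSet_Ioo fun t ht => by
      rw [← mul_assoc, ← mul_assoc, ← ENNReal.mul_rpow_of_nonneg _ _ hp,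
        ← ENNReal.mul_rpow_of_nonneg _ _ hp, ← add_mul]
      gcongr
      exact (ENNReal.rpow_le_rpow (hle t ht) hp).trans (add_rpow_le_add_mul_rpow hp hε hε' _ _)
  have hhigh : ∫⁻ t in Set.Ico (s / K) s, h t ^ p * ENNReal.ofReal (t ^ α) ≤
      ∫⁻ t in Set.Ico (s / K) s, M ^ p * ENNReal.ofReal (t ^ α) :=
    setLIntegral_mono' measurableSet_Ico fun t ht => by gcongr; exact hM t ht
  have hε_top : (1 + ε) ^ p ≠ ∞ := by finiteness
  rw [lintegral_add_right _ (by fun_prop), lintegral_const_mul' _ _ hε_top,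
    lintegral_const_mul _ (by fun_prop),
    lintegral_Ioo_comp_mul_left_mul_rpow (fun t => h t ^ p) α hK ha, ← mul_assoc] at hlow
  rw [lintegral_const_mul _ (by fun_prop)] at hhigh
  have hcover : Set.Ioo (a / K) s ⊆ Set.Ioo (a / K) (s / K) ∪ Set.Ico (s / K) s := fun t ht =>
    (lt_or_ge t (s / K)).imp (fun h => ⟨ht.1, h⟩) fun h => ⟨h, ht.2⟩
  exact (lintegral_mono_set hcover).trans
    ((lintegral_union_le _ _ _).trans (add_le_add hlow hhigh))

/- The contribution of `h (K * t)` cannot be absorbed directly, since the left integral may a priori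
be infinite; the integrals over `(s / K ^ N, s)` are bounded by induction on `N` instead. -/
lemma exists_lintegral_rpow_mul_rpow_le_of_le_comp_mul {p α K s : ℝ} (hp : 0 < p) (hα : -1 < α)
    (hK : 1 < K) (hs : 0 < s) :
    ∃ C ≠ ∞, ∀ (h g : ℝ → ℝ≥0∞) (M : ℝ≥0∞), Measurable g →
      (∀ t ∈ Set.Ioo 0 (s / K), h t ≤ h (K * t) + g t) → (∀ t ∈ Set.Ico (s / K) s, h t ≤ M) →
      ∫⁻ t in Set.Ioo 0 s, h t ^ p * ENNReal.ofReal (t ^ α) ≤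
        C * (M ^ p + ∫⁻ t in Set.Ioo 0 (s / K), g t ^ p * ENNReal.ofReal (t ^ α)) := by
  have hK0 : 0 < K := one_pos.trans hK
  obtain ⟨ε, hε, hε', hθ⟩ := exists_rpow_mul_rpow_lt_one (γ := 1 + α) hp hK (by linarith)
  set θ := (1 + ε) ^ p * ENNReal.ofReal (K ^ (-(1 + α)))
  set W := ∫⁻ t in Set.Ico (s / K) s, ENNReal.ofReal (t ^ α)
  have hW : W ≠ ∞ := (lintegral_Ico_rpow_lt_top (by positivity) s α).ne
  have hθ0 : 1 - θ ≠ 0 := (tsub_pos_of_lt hθ).ne'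
  refine ⟨((1 + ε⁻¹) ^ p + W) * (1 - θ)⁻¹, by finiteness, fun h g M hg hle hM => ?_⟩
  set B := ∫⁻ t in Set.Ioo 0 (s / K), g t ^ p * ENNReal.ofReal (t ^ α)
  set a : ℕ → ℝ≥0∞ := fun N =>
    ∫⁻ t in Set.Ioo (s / K ^ N) s, h t ^ p * ENNReal.ofReal (t ^ α) with ha
  have hsucc (N : ℕ) : a (N + 1) ≤ θ * a N + ((1 + ε⁻¹) ^ p * B + M ^ p * W) := by
    have hsub : Set.Ioo (s / K ^ N / K) (s / K) ⊆ Set.Ioo 0 (s / K) :=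
      Set.Ioo_subset_Ioo_left (by positivity)
    have hB : ∫⁻ t in Set.Ioo (s / K ^ N / K) (s / K), g t ^ p * ENNReal.ofReal (t ^ α) ≤ B :=
      lintegral_mono_set hsub
    have hstep := lintegral_Ioo_rpow_mul_rpow_le_add hp.le hK0 (by positivity) hε hε' hg
      (fun t ht => hle t (hsub ht)) hM (α := α)
    rw [div_div, ← pow_succ, add_assoc] at hstep
    refine hstep.trans ?_
    gcongr
    rwa [div_div, ← pow_succ] at hB
  have hunion : Set.Ioo 0 s ⊆ ⋃ N : ℕ, Set.Ioo (s / K ^ N) s := fun t ht => by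
    obtain ⟨N, hN⟩ := pow_unbounded_of_one_lt (s / t) hK
    exact Set.mem_iUnion.2 ⟨N, (div_lt_comm₀ ht.1 (by positivity)).1 hN, ht.2⟩
  have hmono : Monotone fun N : ℕ => Set.Ioo (s / K ^ N) s := fun N N' hN =>
    Set.Ioo_subset_Ioo_left (by gcongr; exact hK.le)
  calc ∫⁻ t in Set.Ioo 0 s, h t ^ p * ENNReal.ofReal (t ^ α)
      ≤ ∫⁻ t in ⋃ N : ℕ, Set.Ioo (s / K ^ N) s, h t ^ p * ENNReal.ofReal (t ^ α) :=
        lintegral_mono_set hunion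
    _ = ⨆ N, a N := setLIntegral_iUnion_of_directed _ hmono.directed_le
    _ ≤ ((1 + ε⁻¹) ^ p * B + M ^ p * W) * (1 - θ)⁻¹ :=
        iSup_le (le_mul_inv_one_sub_of_le_add_mul hθ (by simp [ha]) hsucc)
    _ ≤ ((1 + ε⁻¹) ^ p * (M ^ p + B) + (M ^ p + B) * W) * (1 - θ)⁻¹ := by
        gcongr
        exacts [le_add_self, le_self_add]
    _ = ((1 + ε⁻¹) ^ p + W) * (1 - θ)⁻¹ * (M ^ p + B) := by ring

lemma exists_lintegral_rpow_mul_rpow_le_of_le_comp_mul_add {p α K s : ℝ} (hp : 0 < p)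
    (hα : -1 < α) (hK : 1 < K) (hs : 0 < s) :
    ∃ C ≠ ∞, ∀ (h g : ℝ → ℝ≥0∞) (M : ℝ≥0∞), Measurable g →
      (∀ t ∈ Set.Ioo 0 (s / K), h t ≤ h (K * t) + (g t + g (K * t))) →
      (∀ t ∈ Set.Ico (s / K) s, h t ≤ M) →
      ∫⁻ t in Set.Ioo 0 s, h t ^ p * ENNReal.ofReal (t ^ α) ≤
        C * (M ^ p + ∫⁻ t in Set.Ioo 0 s, g t ^ p * ENNReal.ofReal (t ^ α)) := by
  have hK0 : 0 < K := one_pos.trans hK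
  obtain ⟨C, hC, hbound⟩ := exists_lintegral_rpow_mul_rpow_le_of_le_comp_mul hp hα hK hs
  set D := ENNReal.ofReal (K ^ (-(1 + α)))
  refine ⟨C * (1 + 2 ^ p * (1 + D)), by finiteness, fun h g M hg hle hM => ?_⟩
  refine (hbound h _ M (by fun_prop) hle hM).trans ?_
  set B := ∫⁻ t in Set.Ioo 0 s, g t ^ p * ENNReal.ofReal (t ^ α)
  have hnear : ∫⁻ t in Set.Ioo 0 (s / K), g t ^ p * ENNReal.ofReal (t ^ α) ≤ B :=
    lintegral_mono_set (Set.Ioo_subset_Ioo_right (div_le_self hs.le hK.le))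
  have hfar : ∫⁻ t in Set.Ioo 0 (s / K), g (K * t) ^ p * ENNReal.ofReal (t ^ α) = D * B := by
    simpa only [zero_div] using
      lintegral_Ioo_comp_mul_left_mul_rpow (fun t => g t ^ p) α hK0 (le_refl 0)
  have hsum : ∫⁻ t in Set.Ioo 0 (s / K), (g t + g (K * t)) ^ p * ENNReal.ofReal (t ^ α) ≤
      2 ^ p * (B + D * B) :=
    calc _ ≤ ∫⁻ t in Set.Ioo 0 (s / K), 2 ^ p *
          (g t ^ p * ENNReal.ofReal (t ^ α) + g (K * t) ^ p * ENNReal.ofReal (t ^ α)) := by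
          refine lintegral_mono fun t => ?_
          rw [← add_mul, ← mul_assoc, mul_add]
          gcongr
          simpa [one_add_one_eq_two, ENNReal.mul_rpow_of_nonneg _ _ hp.le] using
            add_rpow_le_add_mul_rpow hp.le one_ne_zero ENNReal.one_ne_top (g t) (g (K * t))
      _ = 2 ^ p * (_ + D * B) := by
          rw [lintegral_const_mul _ (by fun_prop), lintegral_add_left (by fun_prop), hfar]
      _ ≤ 2 ^ p * (B + D * B) := by gcongr
  calc C * (M ^ p + _) ≤ C * (M ^ p + 2 ^ p * (B + D * B)) := by gcongr
    _ = C * (M ^ p + 2 ^ p * (1 + D) * B) := by ring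
    _ ≤ C * (1 * M ^ p + 2 ^ p * (1 + D) * M ^ p + (1 * B + 2 ^ p * (1 + D) * B)) := by
        rw [one_mul, one_mul]
        gcongr
        exacts [le_self_add, le_add_self]
    _ = C * (1 + 2 ^ p * (1 + D)) * (M ^ p + B) := by ring

end Hardy

section Annulus

open scoped ENNReal

variable {E : Type*} [NormedAddCommGroup E] [NormedSpace ℝ E] [FiniteDimensional ℝ E]
  [MeasurableSpace E] [BorelSpace E] (μ : Measure E) [μ.IsAddHaarMeasure]

lemma setLIntegral_norm_preimage_eq_lintegral_sphere {H : E → ℝ≥0∞} (hH : Measurable H)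
    {S : Set ℝ} (hS : MeasurableSet S) (hS0 : S ⊆ Set.Ioi 0) :
    ∫⁻ z in norm ⁻¹' S, H z ∂μ = ∫⁻ σ : sphere (0 : E) 1, (∫⁻ r in S,
      ENNReal.ofReal (r ^ (Module.finrank ℝ E - 1)) * H (r • (σ : E))) ∂μ.toSphere := by
  have hpre : MeasurableSet (norm ⁻¹' S : Set E) := measurable_norm hS
  have hpre0 : norm ⁻¹' S ⊆ ({0}ᶜ : Set E) := fun z hz => norm_pos_iff.1 (hS0 hz)
  have hray (σ : sphere (0 : E) 1) (r : Set.Ioi (0 : ℝ)) :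
      (norm ⁻¹' S).indicator H ((r : ℝ) • (σ : E)) =
        S.indicator (fun r : ℝ => H (r • (σ : E))) r := by
    have hr : ‖(r : ℝ) • (σ : E)‖ = r := by
      rw [norm_smul, norm_eq_of_mem_sphere, mul_one, Real.norm_of_nonneg (le_of_lt r.2)]
    by_cases h : (r : ℝ) ∈ S <;> simp [hr, h]
  calc ∫⁻ z in norm ⁻¹' S, H z ∂μ
      = ∫⁻ z : ({0}ᶜ : Set E), (norm ⁻¹' S).indicator H z ∂μ.comap (↑) := by
        rw [lintegral_subtype_comap (measurableSet_singleton _).compl, setLIntegral_indicator hpre,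
          Set.inter_eq_left.2 hpre0]
    _ = ∫⁻ x : sphere (0 : E) 1 × Set.Ioi (0 : ℝ), (norm ⁻¹' S).indicator H
          ((x.2 : ℝ) • (x.1 : E)) ∂(μ.toSphere.prod (.volumeIoiPow (Module.finrank ℝ E - 1))) := by
        rw [← μ.measurePreserving_homeomorphUnitSphereProd.lintegral_comp_emb
          (homeomorphUnitSphereProd E).measurableEmbedding]
        simp only [← homeomorphUnitSphereProd_symm_apply_coe,
          Homeomorph.symm_apply_apply]
    _ = ∫⁻ σ : sphere (0 : E) 1, (∫⁻ r : Set.Ioi (0 : ℝ), S.indicator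
          (fun r : ℝ => H (r • (σ : E))) r ∂.volumeIoiPow (Module.finrank ℝ E - 1))
            ∂μ.toSphere := by
        have := hH.indicator hpre
        rw [lintegral_prod _ (by fun_prop)]
        simp only [hray]
    _ = _ := lintegral_congr fun σ => by
        have hmul (r : ℝ) : ENNReal.ofReal (r ^ (Module.finrank ℝ E - 1)) *
            S.indicator (fun r : ℝ => H (r • (σ : E))) r = S.indicator (fun r : ℝ =>
              ENNReal.ofReal (r ^ (Module.finrank ℝ E - 1)) * H (r • (σ : E))) r :=
          (S.indicator_mul_right (fun r : ℝ => ENNReal.ofReal (r ^ _)) _).symm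
        rw [Measure.volumeIoiPow, lintegral_withDensity_eq_lintegral_mul_non_measurable _
          (by fun_prop) (by simp)]
        simp only [Pi.mul_apply, hmul]
        rw [lintegral_subtype_comap measurableSet_Ioi (S.indicator _), setLIntegral_indicator hS,
          Set.inter_eq_left.2 hS0]

lemma setLIntegral_one_sub (Q : ℝ → ℝ≥0∞) (a b : ℝ) :
    ∫⁻ t in Set.Ioo a b, Q (1 - t) = ∫⁻ r in Set.Ioo (1 - b) (1 - a), Q r := by
  rw [← (Measure.measurePreserving_sub_left volume (1 : ℝ)).setLIntegral_comp_preimage_emb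
    (MeasurableEquiv.subLeft (1 : ℝ)).measurableEmbedding]
  simp

lemma setLIntegral_annulus_le_lintegral_sphere {H : E → ℝ≥0∞} (hH : Measurable H) {s : ℝ}
    (hs : s ≤ 1) :
    ∫⁻ z in norm ⁻¹' Set.Ioo (1 - s) 1, H z ∂μ ≤
      ∫⁻ σ : sphere (0 : E) 1, (∫⁻ t in Set.Ioo 0 s, H ((1 - t) • (σ : E))) ∂μ.toSphere := by
  rw [setLIntegral_norm_preimage_eq_lintegral_sphere μ hH measurableSet_Ioo
    fun r hr => (sub_nonneg.2 hs).trans_lt hr.1]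
  refine lintegral_mono fun σ => ?_
  rw [setLIntegral_one_sub fun r => H (r • (σ : E)), sub_zero]
  refine setLIntegral_mono' measurableSet_Ioo fun r hr => mul_le_of_le_one_left' ?_
  exact ENNReal.ofReal_le_one.2 (pow_le_one₀ (by linarith [hr.1]) hr.2.le)

lemma lintegral_sphere_le_setLIntegral_annulus {H : E → ℝ≥0∞} (hH : Measurable H) {s : ℝ}
    (hs : s < 1) :
    ∫⁻ σ : sphere (0 : E) 1, (∫⁻ t in Set.Ioo 0 s, H ((1 - t) • (σ : E))) ∂μ.toSphere ≤
      ENNReal.ofReal ((1 - s)⁻¹ ^ (Module.finrank ℝ E - 1)) *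
        ∫⁻ z in norm ⁻¹' Set.Ioo (1 - s) 1, H z ∂μ := by
  have hs0 : 0 < 1 - s := sub_pos.2 hs
  rw [setLIntegral_norm_preimage_eq_lintegral_sphere μ hH measurableSet_Ioo
    fun r hr => hs0.trans hr.1, ← lintegral_const_mul' _ _ ENNReal.ofReal_ne_top]
  refine lintegral_mono fun σ => ?_
  rw [setLIntegral_one_sub fun r => H (r • (σ : E)), sub_zero,
    ← lintegral_const_mul' _ _ ENNReal.ofReal_ne_top]
  refine setLIntegral_mono' measurableSet_Ioo fun r hr => ?_
  rw [← mul_assoc, ← ENNReal.ofReal_mul (by positivity), ← mul_pow]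
  refine le_mul_of_one_le_left' (ENNReal.one_le_ofReal.2 (one_le_pow₀ ?_))
  rw [inv_mul_eq_div, one_le_div hs0]
  exact hr.1.le

end Annulus

section Radial

open scoped ENNReal

variable {E : Type*} [NormedAddCommGroup E]

lemma setLIntegral_closedBall_rpow_mul_rpow_lt_top [ProperSpace E] [MeasurableSpace E]
    [BorelSpace E] (μ : Measure E) [IsFiniteMeasureOnCompacts μ] {F : Type*}
    [NormedAddCommGroup F] {p : ℝ} (hp : 0 ≤ p) (α : ℝ) {f : E → F} {r : ℝ} (hr : r < 1)
    (hf : ContinuousOn f (closedBall 0 r)) :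
    ∫⁻ z in closedBall 0 r, ‖f z‖ₑ ^ p * ENNReal.ofReal ((1 - ‖z‖) ^ α) ∂μ < ∞ := by
  have hweight : ContinuousOn (fun z : E => (1 - ‖z‖) ^ α) (closedBall 0 r) :=
    (by fun_prop : Continuous fun z : E => 1 - ‖z‖).continuousOn.rpow_const fun z hz =>
      .inl (sub_pos.2 ((mem_closedBall_zero_iff.1 hz).trans_lt hr)).ne'
  have hintegrable : IntegrableOn (fun z => ‖f z‖ ^ p * (1 - ‖z‖) ^ α) (closedBall 0 r) μ :=
    ((hf.norm.rpow_const fun _ _ => .inr hp).mul hweight).integrableOn_compact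
      (isCompact_closedBall 0 r)
  convert hintegrable.lintegral_lt_top using 3 with z
  rw [ENNReal.ofReal_mul (by positivity), ← ofReal_norm,
    ENNReal.ofReal_rpow_of_nonneg (by positivity) hp]

lemma measurable_indicator_enorm_of_continuousOn {X F : Type*} [TopologicalSpace X]
    [MeasurableSpace X] [BorelSpace X] [SeminormedAddCommGroup F] {f : X → F} {s : Set X}
    (hf : ContinuousOn f s) (hs : MeasurableSet s) : Measurable (s.indicator fun z => ‖f z‖ₑ) := by
  classical
  rw [← Set.piecewise_eq_indicator]
  exact hf.enorm.measurable_piecewise continuousOn_const hs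

variable [NormedSpace ℝ E]

lemma norm_one_sub_smul {σ : E} (hσ : ‖σ‖ = 1) {t : ℝ} (ht : t ≤ 1) : ‖(1 - t) • σ‖ = 1 - t := by
  rw [norm_smul, hσ, mul_one, Real.norm_of_nonneg (sub_nonneg.2 ht)]

lemma setLIntegral_Ioo_one_sub_norm_smul {s : ℝ} (hs : s < 1) {σ : E} (hσ : ‖σ‖ = 1)
    (w : ℝ → ℝ≥0∞) (h : E → ℝ≥0∞) :
    ∫⁻ t in Set.Ioo 0 s, h ((1 - t) • σ) * w (1 - ‖(1 - t) • σ‖) =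
      ∫⁻ t in Set.Ioo 0 s, h ((1 - t) • σ) * w t :=
  setLIntegral_congr_fun measurableSet_Ioo fun t ht => by
    simp only [norm_one_sub_smul hσ (ht.2.trans hs).le, sub_sub_cancel]

lemma le_add_on_ray {K s t : ℝ} (hK : 1 ≤ K) (hs : s < 1) {f g : E → ℝ≥0∞}
    (hle : ∀ z ∈ ball 0 1, ∀ w ∈ ball 0 1, 1 - ‖w‖ = K * (1 - ‖z‖) → ‖z - w‖ = ‖z‖ - ‖w‖ →
      f z ≤ f w + (g z + g w)) {σ : E} (hσ : ‖σ‖ = 1) (ht : t ∈ Set.Ioo 0 (s / K)) :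
    f ((1 - t) • σ) ≤ f ((1 - K * t) • σ) + (g ((1 - t) • σ) + g ((1 - K * t) • σ)) := by
  have hKt : K * t < s := mul_comm t K ▸ (lt_div_iff₀ (by linarith)).1 ht.2
  have ht_le : t ≤ K * t := le_mul_of_one_le_left ht.1.le hK
  have hz := norm_one_sub_smul hσ (t := t) (by linarith)
  have hw := norm_one_sub_smul hσ (t := K * t) (by linarith)
  refine hle _ ?_ _ ?_ ?_ ?_
  · rw [mem_ball_zero_iff, hz]; linarith [ht.1]
  · rw [mem_ball_zero_iff, hw]; linarith [ht.1]
  · rw [hz, hw]; ring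
  · rw [hz, hw, ← sub_smul, norm_smul, hσ, Real.norm_of_nonneg (by linarith), mul_one]

variable [FiniteDimensional ℝ E] [MeasurableSpace E] [BorelSpace E]
  (μ : Measure E) [μ.IsAddHaarMeasure]

lemma setLIntegral_annulus_rpow_mul_rpow_lt_top {p α K s : ℝ} (hp : 0 < p) (hα : -1 < α)
    (hK : 1 < K) (hs : 0 < s) (hs1 : s < 1) {f g : E → ℝ≥0∞} (hf : Measurable f)
    (hg : Measurable g) {M : ℝ≥0∞} (hM : M ≠ ∞) (hfM : ∀ z ∈ closedBall 0 (1 - s / K), f z ≤ M)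
    (hle : ∀ z ∈ ball 0 1, ∀ w ∈ ball 0 1, 1 - ‖w‖ = K * (1 - ‖z‖) → ‖z - w‖ = ‖z‖ - ‖w‖ →
      f z ≤ f w + (g z + g w))
    (hgp : ∫⁻ z in norm ⁻¹' Set.Ioo (1 - s) 1, g z ^ p * ENNReal.ofReal ((1 - ‖z‖) ^ α) ∂μ < ∞) :
    ∫⁻ z in norm ⁻¹' Set.Ioo (1 - s) 1, f z ^ p * ENNReal.ofReal ((1 - ‖z‖) ^ α) ∂μ < ∞ := by
  have hray (h : E → ℝ≥0∞) (σ : sphere (0 : E) 1) :=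
    setLIntegral_Ioo_one_sub_norm_smul hs1 (norm_eq_of_mem_sphere σ)
      (fun t => ENNReal.ofReal (t ^ α)) (fun z => h z ^ p)
  obtain ⟨C, hC, hbound⟩ :=
    exists_lintegral_rpow_mul_rpow_le_of_le_comp_mul_add (s := s) hp hα hK hs
  have hHardy (σ : sphere (0 : E) 1) := hbound (fun t => f ((1 - t) • (σ : E)))
    (fun t => g ((1 - t) • (σ : E))) M (by fun_prop)
    (fun t ht => le_add_on_ray hK.le hs1 hle (norm_eq_of_mem_sphere σ) ht)
    fun t ht => hfM _ <| mem_closedBall_zero_iff.2 <| by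
      rw [norm_one_sub_smul (norm_eq_of_mem_sphere σ) (ht.2.trans hs1).le]
      linarith [ht.1]
  have hg_sphere := lintegral_sphere_le_setLIntegral_annulus μ
    (H := fun z => g z ^ p * ENNReal.ofReal ((1 - ‖z‖) ^ α)) (by fun_prop) hs1
  simp only [hray] at hg_sphere
  refine (setLIntegral_annulus_le_lintegral_sphere μ (by fun_prop) hs1.le).trans_lt ?_
  simp only [hray]
  refine (lintegral_mono hHardy).trans_lt ?_
  rw [lintegral_const_mul' _ _ hC, lintegral_add_left measurable_const, lintegral_const]
  have hMp : M ^ p ≠ ∞ := by finiteness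
  have hg_top := (hg_sphere.trans_lt (ENNReal.mul_lt_top ENNReal.ofReal_lt_top hgp)).ne
  finiteness

lemma setLIntegral_ball_rpow_mul_rpow_lt_top_of_norm_sub_le {F : Type*} [NormedAddCommGroup F]
    {p α K : ℝ} (hp : 0 < p) (hα : -1 < α) (hK : 1 < K) {f : E → F} {g : E → ℝ}
    (hf : ContinuousOn f (ball 0 1)) (hg : ContinuousOn g (ball 0 1))
    (hle : ∀ z ∈ ball 0 1, ∀ w ∈ ball 0 1, 1 - ‖w‖ = K * (1 - ‖z‖) → ‖z - w‖ = ‖z‖ - ‖w‖ →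
      ‖f z - f w‖ ≤ g z + g w)
    (hgp : ∫⁻ z in ball 0 1, ‖g z‖ₑ ^ p * ENNReal.ofReal ((1 - ‖z‖) ^ α) ∂μ < ∞) :
    ∫⁻ z in ball 0 1, ‖f z‖ₑ ^ p * ENNReal.ofReal ((1 - ‖z‖) ^ α) ∂μ < ∞ := by
  set I := (ball (0 : E) 1).indicator (M := ℝ≥0∞)
  have hI {h : E → ℝ≥0∞} {z : E} (hz : z ∈ ball 0 1) : I h z = h z := Set.indicator_of_mem hz _
  have hcover : ball (0 : E) 1 ⊆ closedBall 0 (1 - 1 / 2) ∪ norm ⁻¹' Set.Ioo (1 - 1 / 2) 1 :=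
    fun z hz => (le_or_gt ‖z‖ (1 - 1 / 2)).imp mem_closedBall_zero_iff.2
      fun h => ⟨h, mem_ball_zero_iff.1 hz⟩
  have hannulus (h : E → ℝ≥0∞) :
      ∫⁻ z in norm ⁻¹' Set.Ioo (1 - 1 / 2) 1, I h z ^ p * ENNReal.ofReal ((1 - ‖z‖) ^ α) ∂μ =
        ∫⁻ z in norm ⁻¹' Set.Ioo (1 - 1 / 2) 1, h z ^ p * ENNReal.ofReal ((1 - ‖z‖) ^ α) ∂μ :=
    setLIntegral_congr_fun (measurable_norm measurableSet_Ioo) fun z hz => by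
      simp only [hI (mem_ball_zero_iff.2 hz.2)]
  have hsub {r : ℝ} (hr : r < 1) : closedBall (0 : E) r ⊆ ball 0 1 := closedBall_subset_ball hr
  have hradius : 1 - 1 / 2 / K < 1 := sub_lt_self _ (by positivity)
  obtain ⟨M, hM⟩ := (isCompact_closedBall (0 : E) (1 - 1 / 2 / K)).exists_bound_of_continuousOn
    (hf.mono (hsub hradius))
  refine (lintegral_mono_set hcover).trans_lt ((lintegral_union_le _ _ _).trans_lt
    (ENNReal.add_lt_top.2 ⟨setLIntegral_closedBall_rpow_mul_rpow_lt_top μ hp.le α (by norm_num)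
      (hf.mono (hsub (by norm_num))), hannulus (‖f ·‖ₑ) ▸ ?_⟩))
  refine setLIntegral_annulus_rpow_mul_rpow_lt_top μ hp hα hK one_half_pos one_half_lt_one
    (g := I (‖g ·‖ₑ)) (measurable_indicator_enorm_of_continuousOn hf measurableSet_ball)
    (measurable_indicator_enorm_of_continuousOn hg measurableSet_ball)
    (ENNReal.ofReal_ne_top (r := M)) (fun z hz => ?_) (fun z hz w hw hzw hzw' => ?_)
    (hannulus (‖g ·‖ₑ) ▸ (lintegral_mono_set fun z hz => mem_ball_zero_iff.2 hz.2).trans_lt hgp)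
  · rw [hI (hsub hradius hz), ← ofReal_norm]
    exact ENNReal.ofReal_le_ofReal (hM z hz)
  · rw [hI hz, hI hw, hI hz, hI hw]
    simp only [← ofReal_norm]
    rw [← ENNReal.ofReal_add (by positivity) (by positivity),
      ← ENNReal.ofReal_add (by positivity) (by positivity)]
    refine ENNReal.ofReal_le_ofReal ?_
    linarith [norm_sub_norm_le (f z) (f w), hle z hz w hw hzw hzw', Real.le_norm_self (g z),
      Real.le_norm_self (g w)]

end Radial

section WeightedVolume

open scoped ENNReal

lemma rpow_le_two_rpow_abs {x : ℝ} (hx1 : 1 ≤ x) (hx2 : x ≤ 2) (α : ℝ) : x ^ α ≤ 2 ^ |α| :=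
  (Real.rpow_le_rpow_of_exponent_le hx1 (le_abs_self α)).trans
    (Real.rpow_le_rpow (by positivity) hx2 (abs_nonneg α))

lemma one_sub_sq_rpow {r : ℝ} (h0 : 0 ≤ r) (h1 : r < 1) (α : ℝ) :
    (1 - r ^ 2) ^ α = (1 + r) ^ α * (1 - r) ^ α := by
  rw [← Real.mul_rpow (by positivity) (by linarith)]
  ring_nf

lemma one_sub_sq_rpow_le {r : ℝ} (h0 : 0 ≤ r) (h1 : r < 1) (α : ℝ) :
    (1 - r ^ 2) ^ α ≤ 2 ^ |α| * (1 - r) ^ α := by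
  rw [one_sub_sq_rpow h0 h1]
  exact mul_le_mul_of_nonneg_right (rpow_le_two_rpow_abs (by linarith) (by linarith) α)
    (Real.rpow_nonneg (by linarith) α)

lemma one_sub_rpow_le {r : ℝ} (h0 : 0 ≤ r) (h1 : r < 1) (α : ℝ) :
    (1 - r) ^ α ≤ 2 ^ |α| * (1 - r ^ 2) ^ α := by
  have : 0 < 1 - r := sub_pos.2 h1
  calc (1 - r) ^ α = (1 + r) ^ (-α) * (1 - r ^ 2) ^ α := by
        rw [one_sub_sq_rpow h0 h1, ← mul_assoc, ← Real.rpow_add (by positivity), neg_add_cancel,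
          Real.rpow_zero, one_mul]
    _ ≤ 2 ^ |α| * (1 - r ^ 2) ^ α := by
        rw [← abs_neg α]
        exact mul_le_mul_of_nonneg_right (rpow_le_two_rpow_abs (by linarith) (by linarith) _)
          (Real.rpow_nonneg (by nlinarith) α)

lemma setLIntegral_mul_ofReal_lt_top_of_le {X : Type*} [MeasurableSpace X] {μ : Measure X}
    {s : Set X} (hs : MeasurableSet s) {c : ℝ} (hc : 0 ≤ c) {v w : X → ℝ}
    (hle : ∀ x ∈ s, v x ≤ c * w x) {H : X → ℝ≥0∞}
    (h : ∫⁻ x in s, H x * ENNReal.ofReal (w x) ∂μ < ∞) :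
    ∫⁻ x in s, H x * ENNReal.ofReal (v x) ∂μ < ∞ := by
  refine (setLIntegral_mono' (g := fun x => ENNReal.ofReal c * (H x * ENNReal.ofReal (w x))) hs
    fun x hx => ?_).trans_lt ?_
  · rw [mul_left_comm, ← ENNReal.ofReal_mul hc]
    gcongr
    exact hle x hx
  · rw [lintegral_const_mul' _ _ ENNReal.ofReal_ne_top]
    exact ENNReal.mul_lt_top ENNReal.ofReal_lt_top h

lemma setLIntegral_ball_one_sub_sq_lt_top_iff {E : Type*} [NormedAddCommGroup E]
    [MeasurableSpace E] [OpensMeasurableSpace E] {μ : Measure E} {H : E → ℝ≥0∞} {α : ℝ} :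
    ∫⁻ z in ball 0 1, H z * ENNReal.ofReal ((1 - ‖z‖ ^ 2) ^ α) ∂μ < ∞ ↔
      ∫⁻ z in ball 0 1, H z * ENNReal.ofReal ((1 - ‖z‖) ^ α) ∂μ < ∞ :=
  ⟨setLIntegral_mul_ofReal_lt_top_of_le measurableSet_ball (by positivity) fun z hz =>
      one_sub_rpow_le (norm_nonneg z) (mem_ball_zero_iff.1 hz) α,
    setLIntegral_mul_ofReal_lt_top_of_le measurableSet_ball (by positivity) fun z hz =>
      one_sub_sq_rpow_le (norm_nonneg z) (mem_ball_zero_iff.1 hz) α⟩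

variable {n : ℕ} {α : ℝ}

lemma setLIntegral_ball_one_sub_sq_lt_top (hα : -1 < α) :
    ∫⁻ z : CSpace n in ball 0 1, ENNReal.ofReal ((1 - ‖z‖ ^ 2) ^ α) < ∞ := by
  have h := setLIntegral_ball_rpow_mul_rpow_lt_top_of_norm_sub_le (volume : Measure (CSpace n))
    (p := 1) (f := fun _ => (1 : ℝ)) (g := 0) one_pos hα one_lt_two continuousOn_const
    continuousOn_const (by simp) (by simp)
  simpa using setLIntegral_ball_one_sub_sq_lt_top_iff.2 h

lemma setLIntegral_ball_one_sub_sq_ne_zero :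
    ∫⁻ z : CSpace n in ball 0 1, ENNReal.ofReal ((1 - ‖z‖ ^ 2) ^ α) ≠ 0 := by
  refine ((setLIntegral_pos_iff (by fun_prop)).2 ?_).ne'
  refine (measure_ball_pos volume (0 : CSpace n) one_pos).trans_le (measure_mono fun z hz => ?_)
  exact ⟨(ENNReal.ofReal_pos.2 (Real.rpow_pos_of_pos
    (one_sub_norm_sq_pos (mem_ball_zero_iff.1 hz)) α)).ne', hz⟩

lemma weightedVolume_eq_smul_withDensity (hα : -1 < α) : ∃ c : ℝ≥0∞, c ≠ 0 ∧ c ≠ ∞ ∧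
    weightedVolume n α = c • (volume.restrict (ball (0 : CSpace n) 1)).withDensity
      fun z => ENNReal.ofReal ((1 - ‖z‖ ^ 2) ^ α) := by
  have hV0 : volume (ball (0 : CSpace n) 1) ≠ 0 := (measure_ball_pos _ _ one_pos).ne'
  have hVt : volume (ball (0 : CSpace n) 1) ≠ ∞ := measure_ball_lt_top.ne
  have haux : weightedVolumeAux n α = (volume (ball (0 : CSpace n) 1))⁻¹ •
      (volume.restrict (ball (0 : CSpace n) 1)).withDensity
        fun z => ENNReal.ofReal ((1 - ‖z‖ ^ 2) ^ α) := by
    rw [weightedVolumeAux, ballVolume, withDensity_smul_measure, unitBall]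
  have huniv : weightedVolumeAux n α Set.univ = (volume (ball (0 : CSpace n) 1))⁻¹ *
      ∫⁻ z : CSpace n in ball 0 1, ENNReal.ofReal ((1 - ‖z‖ ^ 2) ^ α) := by
    rw [haux, Measure.smul_apply, withDensity_apply _ MeasurableSet.univ, Measure.restrict_univ,
      smul_eq_mul]
  have huniv0 : weightedVolumeAux n α Set.univ ≠ 0 :=
    huniv ▸ mul_ne_zero (ENNReal.inv_ne_zero.2 hVt) setLIntegral_ball_one_sub_sq_ne_zero
  have hunivt : weightedVolumeAux n α Set.univ ≠ ∞ :=
    huniv ▸ ENNReal.mul_ne_top (ENNReal.inv_ne_top.2 hV0)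
      (setLIntegral_ball_one_sub_sq_lt_top hα).ne
  exact ⟨(weightedVolumeAux n α Set.univ)⁻¹ * (volume (ball (0 : CSpace n) 1))⁻¹,
    mul_ne_zero (ENNReal.inv_ne_zero.2 hunivt) (ENNReal.inv_ne_zero.2 hVt),
    ENNReal.mul_ne_top (ENNReal.inv_ne_top.2 huniv0) (ENNReal.inv_ne_top.2 hV0),
    by rw [weightedVolume, haux, smul_smul, ← haux]⟩

variable {E : Type*} [NormedAddCommGroup E] {p : ℝ} {f : CSpace n → E}

lemma memLp_weightedVolume_iff (hp : 0 < p) (hα : -1 < α) (hf : ContinuousOn f (ball 0 1)) :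
    MemLp f (ENNReal.ofReal p) (weightedVolume n α) ↔
      ∫⁻ z in ball 0 1, ‖f z‖ₑ ^ p * ENNReal.ofReal ((1 - ‖z‖) ^ α) < ∞ := by
  obtain ⟨c, hc0, hct, hc⟩ := weightedVolume_eq_smul_withDensity (n := n) hα
  have hmeas : AEStronglyMeasurable f (weightedVolume n α) := by
    rw [hc]
    exact (hf.aestronglyMeasurable (μ := volume) measurableSet_ball).mono_ac
      (Measure.smul_absolutelyContinuous.trans (withDensity_absolutelyContinuous _ _))
  rw [← setLIntegral_ball_one_sub_sq_lt_top_iff, MemLp, and_iff_right hmeas,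
    eLpNorm_lt_top_iff_lintegral_rpow_enorm_lt_top (ENNReal.ofReal_pos.2 hp).ne'
      ENNReal.ofReal_ne_top, ENNReal.toReal_ofReal hp.le, hc, lintegral_smul_measure,
    lintegral_withDensity_eq_lintegral_mul_non_measurable _ (by fun_prop)
      (ae_of_all _ fun _ => ENNReal.ofReal_lt_top), smul_eq_mul]
  simp only [Pi.mul_apply, mul_comm (ENNReal.ofReal _)]
  exact ⟨fun h => ENNReal.lt_top_of_mul_ne_top_right h.ne hc0, ENNReal.mul_lt_top hct.lt_top⟩

lemma memLp_div_one_sub_norm_iff (hp : 0 < p) (hα : -1 < α) {g : CSpace n → ℝ}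
    (hg : ContinuousOn g (ball 0 1)) :
    MemLp (fun z => g z / (1 - ‖z‖)) (ENNReal.ofReal p) (weightedVolume n (p + α)) ↔
      MemLp g (ENNReal.ofReal p) (weightedVolume n α) := by
  have hcont : ContinuousOn (fun z => g z / (1 - ‖z‖)) (ball 0 1) :=
    hg.div (by fun_prop) fun z hz => (sub_pos.2 (mem_ball_zero_iff.1 hz)).ne'
  rw [memLp_weightedVolume_iff hp (by linarith) hcont, memLp_weightedVolume_iff hp hα hg]
  refine iff_of_eq (congrArg (· < ∞) (setLIntegral_congr_fun measurableSet_ball fun z hz => ?_))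
  have hz : 0 < 1 - ‖z‖ := sub_pos.2 (mem_ball_zero_iff.1 hz)
  simp only [← ofReal_norm]
  rw [ENNReal.ofReal_rpow_of_nonneg (by positivity) hp.le,
    ENNReal.ofReal_rpow_of_nonneg (by positivity) hp.le, ← ENNReal.ofReal_mul (by positivity),
    ← ENNReal.ofReal_mul (by positivity), norm_div, Real.norm_of_nonneg hz.le,
    Real.div_rpow (by positivity) hz.le, Real.rpow_add hz, ← mul_assoc,
    div_mul_cancel₀ _ (Real.rpow_pos_of_pos hz p).ne']

end WeightedVolume

section Jacobian

open scoped ENNReal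

variable {n : ℕ}

/-- The real Jacobian determinant of `ballInvolution a` at `z`, in absolute value. -/
noncomputable def involutionJacobian (a z : CSpace n) : ℝ :=
  ((1 - ‖a‖ ^ 2) / ‖1 - inner ℂ a z‖ ^ 2) ^ (n + 1)

lemma norm_one_sub_inner_comm (a z : CSpace n) : ‖1 - inner ℂ a z‖ = ‖1 - inner ℂ z a‖ := by
  rw [← inner_conj_symm a z, ← Complex.norm_conj, map_sub, map_one, Complex.conj_conj]

lemma continuousOn_involutionJacobian : ContinuousOn
    (fun x : CSpace n × CSpace n => involutionJacobian x.1 x.2) (ball 0 1 ×ˢ ball 0 1) := by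
  refine ContinuousOn.pow (ContinuousOn.div (by fun_prop) (by fun_prop) fun x hx => ?_) _
  rw [Set.mem_prod, mem_ball_zero_iff, mem_ball_zero_iff] at hx
  exact pow_ne_zero _ (norm_ne_zero_iff.2 (one_sub_inner_ne_zero hx.1 hx.2.le))

lemma lintegral_image_ballInvolution {a : CSpace n} (ha : ‖a‖ < 1) {s : Set (CSpace n)}
    (hs : MeasurableSet s) (hs1 : s ⊆ ball 0 1) (H : CSpace n → ℝ≥0∞) :
    ∫⁻ z in ballInvolution a '' s, H z =
      ∫⁻ z in s, ENNReal.ofReal (involutionJacobian a z) * H (ballInvolution a z) := by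
  rw [lintegral_image_eq_lintegral_abs_det_fderiv_mul volume hs
    (f' := fun z => (involutionDeriv a z).restrictScalars ℝ)
    (fun z hz => ((hasFDerivAt_ballInvolution ha
      (mem_ball_zero_iff.1 (hs1 hz)).le).restrictScalars ℝ).hasFDerivWithinAt)
    ((bijOn_ballInvolution ha).injOn.mono hs1) H]
  refine setLIntegral_congr_fun hs fun z hz => ?_
  simp only [abs_det_involutionDeriv ha (mem_ball_zero_iff.1 (hs1 hz)).le, involutionJacobian]

lemma lintegral_involutionJacobian {a : CSpace n} (ha : ‖a‖ < 1) :
    ∫⁻ z in ball 0 1, ENNReal.ofReal (involutionJacobian a z) = volume (ball (0 : CSpace n) 1) := by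
  have h := lintegral_image_ballInvolution ha measurableSet_ball subset_rfl fun _ => 1
  rw [(bijOn_ballInvolution ha).image_eq] at h
  simpa using h.symm

lemma continuousOn_ballInvolution {a : CSpace n} (ha : ‖a‖ < 1) :
    ContinuousOn (ballInvolution a) (ball 0 1) := fun _ hz =>
  (hasFDerivAt_ballInvolution ha (mem_ball_zero_iff.1 hz).le).continuousAt.continuousWithinAt

lemma setLIntegral_ball_comp_ballInvolution {a : CSpace n} (ha : ‖a‖ < 1) {r : ℝ} (hr : r ≤ 1)
    (H : CSpace n → ℝ≥0∞) :
    ∫⁻ v in ball 0 r, H (ballInvolution a v) =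
      ∫⁻ u in ball 0 1 ∩ ballInvolution a ⁻¹' ball 0 r,
        ENNReal.ofReal (involutionJacobian a u) * H u := by
  have himage : ballInvolution a '' (ball 0 1 ∩ ballInvolution a ⁻¹' ball 0 r) = ball 0 r := by
    rw [Set.image_inter_preimage, (bijOn_ballInvolution ha).image_eq,
      Set.inter_eq_right.2 (ball_subset_ball hr)]
  have hmeas := ((continuousOn_ballInvolution ha).isOpen_inter_preimage isOpen_ball
    (isOpen_ball (x := (0 : CSpace n)) (ε := r))).measurableSet
  rw [← himage, lintegral_image_ballInvolution ha hmeas Set.inter_subset_left, himage]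
  exact setLIntegral_congr_fun hmeas fun u hu => by
    simp only [ballInvolution_ballInvolution ha (mem_ball_zero_iff.1 hu.1).le]

lemma one_sub_norm_sq_le_two_mul {a z : CSpace n} (ha : ‖a‖ < 1) (hz : ‖z‖ ≤ 1) :
    1 - ‖a‖ ^ 2 ≤ 2 * ‖1 - inner ℂ a z‖ := by
  nlinarith [norm_nonneg a, one_sub_norm_le_norm_one_sub_inner (a := a) hz]

lemma one_sub_norm_sq_le_of_norm_ballInvolution_le {a z : CSpace n} (ha : ‖a‖ < 1) (hz : ‖z‖ < 1)
    {r : ℝ} (hr : r < 1) (h : ‖ballInvolution a z‖ ≤ r) :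
    1 - ‖a‖ ^ 2 ≤ 4 / (1 - r ^ 2) * (1 - ‖z‖ ^ 2) := by
  have hA := one_sub_norm_sq_pos ha
  have hr' : 0 < 1 - r ^ 2 := by nlinarith [(norm_nonneg _).trans h]
  have hinner := norm_pos_iff.2 (one_sub_inner_ne_zero ha hz.le)
  have hρ : 1 - r ^ 2 ≤ (1 - ‖a‖ ^ 2) * (1 - ‖z‖ ^ 2) / ‖1 - inner ℂ a z‖ ^ 2 := by
    rw [← one_sub_norm_ballInvolution_sq ha hz.le]
    gcongr
  have hsq : (1 - ‖a‖ ^ 2) ^ 2 ≤ 4 * ‖1 - inner ℂ a z‖ ^ 2 := by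
    nlinarith [one_sub_norm_sq_le_two_mul ha hz.le]
  rw [le_div_iff₀ (by positivity)] at hρ
  rw [div_mul_eq_mul_div, le_div_iff₀ hr']
  refine le_of_mul_le_mul_left (a := 1 - ‖a‖ ^ 2) ?_ hA
  nlinarith

lemma rpow_mul_involutionJacobian_le {a z : CSpace n} (ha : ‖a‖ < 1) (hz : ‖z‖ < 1) {r : ℝ}
    (hr : r < 1) (h : ‖ballInvolution a z‖ ≤ r) {α : ℝ} (hα : 0 ≤ α + (n + 1)) :
    (1 - ‖a‖ ^ 2) ^ α * involutionJacobian a z ≤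
      (4 / (1 - r ^ 2)) ^ (α + (n + 1)) * ((1 - ‖z‖ ^ 2) ^ α * involutionJacobian z a) := by
  have hA := one_sub_norm_sq_pos ha
  have hB := one_sub_norm_sq_pos hz
  have hr' : 0 < 1 - r ^ 2 := by nlinarith [(norm_nonneg _).trans h]
  have hpow {x : ℝ} (hx : 0 < x) : x ^ (α + (n + 1)) = x ^ α * x ^ (n + 1) := by
    rw [Real.rpow_add hx]; exact_mod_cast rfl
  have hle := Real.rpow_le_rpow hA.le
    (one_sub_norm_sq_le_of_norm_ballInvolution_le ha hz hr h) hα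
  rw [Real.mul_rpow (by positivity) hB.le, hpow hA, hpow hB] at hle
  rw [involutionJacobian, involutionJacobian, norm_one_sub_inner_comm z a, div_pow, div_pow,
    mul_div_assoc', mul_div_assoc', mul_div_assoc']
  gcongr

lemma aemeasurable_mul_involutionJacobian {H : CSpace n → ℝ≥0∞}
    (hH : AEMeasurable H (volume.restrict (ball 0 1))) :
    AEMeasurable
      (fun x : CSpace n × CSpace n => H x.2 * ENNReal.ofReal (involutionJacobian x.2 x.1))
      ((volume.restrict (ball 0 1)).prod (volume.restrict (ball 0 1))) := by
  have hJ : AEMeasurable (fun x : CSpace n × CSpace n => involutionJacobian x.2 x.1)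
      ((volume.restrict (ball 0 1)).prod (volume.restrict (ball 0 1))) := by
    rw [Measure.prod_restrict]
    exact (continuousOn_involutionJacobian.comp (f := Prod.swap) continuous_swap.continuousOn
      fun x hx => hx.symm).aemeasurable (measurableSet_ball.prod measurableSet_ball)
  exact hH.comp_snd.mul hJ.ennreal_ofReal

lemma lintegral_lintegral_mul_involutionJacobian {H : CSpace n → ℝ≥0∞}
    (hH : AEMeasurable H (volume.restrict (ball 0 1))) :
    ∫⁻ z in ball 0 1, ∫⁻ u in ball 0 1, H u * ENNReal.ofReal (involutionJacobian u z) =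
      (∫⁻ u in ball 0 1, H u) * volume (ball (0 : CSpace n) 1) := by
  rw [lintegral_lintegral_swap (aemeasurable_mul_involutionJacobian hH),
    ← lintegral_mul_const' _ _ measure_ball_lt_top.ne]
  refine setLIntegral_congr_fun measurableSet_ball fun u hu => ?_
  have hJ : ContinuousOn (involutionJacobian u) (ball 0 1) :=
    continuousOn_involutionJacobian.comp (f := (u, ·)) (by fun_prop) fun z hz => ⟨hu, hz⟩
  rw [lintegral_const_mul'' _ (hJ.aemeasurable measurableSet_ball).ennreal_ofReal,
    lintegral_involutionJacobian (mem_ball_zero_iff.1 hu)]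

lemma rpow_mul_setLIntegral_comp_ballInvolution_le {α r : ℝ} (hα : 0 ≤ α + (n + 1)) (hr : r < 1)
    (H : CSpace n → ℝ≥0∞) {z : CSpace n} (hz : ‖z‖ < 1) :
    ENNReal.ofReal ((1 - ‖z‖ ^ 2) ^ α) * ∫⁻ v in ball 0 r, H (ballInvolution z v) ≤
      ENNReal.ofReal ((4 / (1 - r ^ 2)) ^ (α + (n + 1))) * ∫⁻ u in ball 0 1,
        H u * ENNReal.ofReal ((1 - ‖u‖ ^ 2) ^ α) * ENNReal.ofReal (involutionJacobian u z) := by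
  rw [setLIntegral_ball_comp_ballInvolution hz hr.le,
    ← lintegral_const_mul' _ _ ENNReal.ofReal_ne_top,
    ← lintegral_const_mul' _ _ ENNReal.ofReal_ne_top]
  have hmeas := ((continuousOn_ballInvolution hz).isOpen_inter_preimage isOpen_ball
    (isOpen_ball (x := (0 : CSpace n)) (ε := r))).measurableSet
  refine (setLIntegral_mono' hmeas fun u hu => ?_).trans (lintegral_mono_set Set.inter_subset_left)
  have hu1 := mem_ball_zero_iff.1 hu.1
  have hA := one_sub_norm_sq_pos hz
  have hB := one_sub_norm_sq_pos hu1
  have hJ : 0 ≤ involutionJacobian u z := by unfold involutionJacobian; positivity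
  rw [mul_assoc (H u), mul_left_comm _ (H u), ← mul_assoc, mul_comm _ (H u)]
  refine mul_le_mul_right ?_ _
  rw [← ENNReal.ofReal_mul (by positivity), ← ENNReal.ofReal_mul (by positivity),
    ← ENNReal.ofReal_mul' (by positivity)]
  exact ENNReal.ofReal_le_ofReal
    (rpow_mul_involutionJacobian_le hz hu1 hr (mem_ball_zero_iff.1 hu.2).le hα)

lemma lintegral_rpow_mul_setLIntegral_comp_ballInvolution_le {α r : ℝ} (hα : 0 ≤ α + (n + 1))
    (hr : r < 1) {H : CSpace n → ℝ≥0∞} (hH : AEMeasurable H (volume.restrict (ball 0 1))) :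
    ∫⁻ z in ball 0 1, ENNReal.ofReal ((1 - ‖z‖ ^ 2) ^ α) *
        ∫⁻ v in ball 0 r, H (ballInvolution z v) ≤
      ENNReal.ofReal ((4 / (1 - r ^ 2)) ^ (α + (n + 1))) *
        ((∫⁻ u in ball 0 1, H u * ENNReal.ofReal ((1 - ‖u‖ ^ 2) ^ α)) *
          volume (ball (0 : CSpace n) 1)) := by
  have hHw : AEMeasurable (fun u => H u * ENNReal.ofReal ((1 - ‖u‖ ^ 2) ^ α))
      (volume.restrict (ball 0 1)) := hH.mul (by fun_prop)
  rw [← lintegral_lintegral_mul_involutionJacobian hHw,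
    ← lintegral_const_mul' _ _ ENNReal.ofReal_ne_top]
  exact setLIntegral_mono' measurableSet_ball fun z hz =>
    rpow_mul_setLIntegral_comp_ballInvolution_le hα hr H (mem_ball_zero_iff.1 hz)

end Jacobian

section HyperbolicSup

open scoped ENNReal

lemma continuousOn_sSup_image {X Y : Type*} [TopologicalSpace X] [TopologicalSpace Y] {s : Set X}
    {K : Set Y} (hK : IsCompact K) {f : X → Y → ℝ}
    (hf : ContinuousOn (Function.uncurry f) (s ×ˢ K)) :
    ContinuousOn (fun x => sSup (f x '' K)) s := by
  have : CompactSpace K := isCompact_iff_compactSpace.1 hK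
  rw [continuousOn_iff_continuous_domRestrict]
  convert isCompact_univ.continuous_sSup (f := fun (x : s) (y : K) => f x y)
    (hf.comp_continuous (f := fun q : s × K => (q.1.1, q.2.1)) (by fun_prop)
      fun q => ⟨q.1.2, q.2.2⟩) using 2 with x
  rw [Set.domRestrict_apply, Set.image_univ, ← Set.image_eq_range]

variable {n : ℕ}

lemma continuousOn_uncurry_ballInvolution :
    ContinuousOn (Function.uncurry ballInvolution) (ball (0 : CSpace n) 1 ×ˢ ball 0 1) := by
  have hformula : ContinuousOn (fun q : CSpace n × CSpace n => (1 - inner ℂ q.1 q.2)⁻¹ •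
      (q.1 - ((defect q.1 : ℂ) • q.2 + ((1 + (defect q.1 : ℂ))⁻¹ * inner ℂ q.1 q.2) • q.1)))
      (ball 0 1 ×ˢ ball 0 1) := by
    have hdefect : Continuous fun q : CSpace n × CSpace n => (defect q.1 : ℂ) := by
      unfold defect; fun_prop
    have hinv := (continuous_const.add hdefect).inv₀ fun q => one_add_defect_ne_zero q.1
    have hdenominator : ContinuousOn (fun q : CSpace n × CSpace n => (1 - inner ℂ q.1 q.2)⁻¹)
        (ball 0 1 ×ˢ ball 0 1) := ContinuousOn.inv₀ (by fun_prop) fun q hq =>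
      one_sub_inner_ne_zero (mem_ball_zero_iff.1 hq.1) (mem_ball_zero_iff.1 hq.2).le
    exact hdenominator.smul (continuous_fst.sub ((hdefect.smul continuous_snd).add
      ((hinv.mul (by fun_prop)).smul continuous_fst))).continuousOn
  refine hformula.congr fun q hq => ?_
  simp only [Function.uncurry_def, ballInvolution_eq (mem_ball_zero_iff.1 hq.1),
    involutionLinear_apply]

variable {F : Type*} [NormedAddCommGroup F] {f : CSpace n → F}

/-- The supremum of `‖f‖` over the closed ball of radius `1 / 2` around `z` in the
pseudo-hyperbolic metric. -/
noncomputable def hyperbolicSup (f : CSpace n → F) (z : CSpace n) : ℝ :=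
  sSup ((fun u => ‖f (ballInvolution z u)‖) '' closedBall 0 (1 / 2))

lemma continuousOn_uncurry_norm_comp_ballInvolution (hf : ContinuousOn f (ball 0 1)) :
    ContinuousOn (Function.uncurry fun z u => ‖f (ballInvolution z u)‖)
      (ball 0 1 ×ˢ closedBall 0 (1 / 2)) :=
  (hf.comp continuousOn_uncurry_ballInvolution fun _ hq =>
    (bijOn_ballInvolution (mem_ball_zero_iff.1 hq.1)).mapsTo hq.2).norm.mono
      (Set.prod_mono_right (closedBall_subset_ball one_half_lt_one))

lemma continuousOn_norm_comp_ballInvolution (hf : ContinuousOn f (ball 0 1)) {z : CSpace n}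
    (hz : ‖z‖ < 1) :
    ContinuousOn (fun u => ‖f (ballInvolution z u)‖) (closedBall 0 (1 / 2)) :=
  (continuousOn_uncurry_norm_comp_ballInvolution hf).comp (f := (z, ·)) (by fun_prop)
    fun _ hu => ⟨mem_ball_zero_iff.2 hz, hu⟩

lemma continuousOn_hyperbolicSup (hf : ContinuousOn f (ball 0 1)) :
    ContinuousOn (hyperbolicSup f) (ball 0 1) :=
  continuousOn_sSup_image (isCompact_closedBall 0 (1 / 2))
    (continuousOn_uncurry_norm_comp_ballInvolution hf)

lemma norm_comp_ballInvolution_le_hyperbolicSup (hf : ContinuousOn f (ball 0 1)) {z u : CSpace n}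
    (hz : ‖z‖ < 1) (hu : ‖u‖ ≤ 1 / 2) : ‖f (ballInvolution z u)‖ ≤ hyperbolicSup f z :=
  le_csSup ((isCompact_closedBall 0 (1 / 2)).bddAbove_image
    (continuousOn_norm_comp_ballInvolution hf hz)) ⟨u, mem_closedBall_zero_iff.2 hu, rfl⟩

lemma norm_le_hyperbolicSup (hf : ContinuousOn f (ball 0 1)) {z : CSpace n} (hz : ‖z‖ < 1) :
    ‖f z‖ ≤ hyperbolicSup f z := by
  simpa only [ballInvolution_zero hz] using
    norm_comp_ballInvolution_le_hyperbolicSup hf hz (u := 0) (by simp)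

lemma exists_hyperbolicSup_eq (hf : ContinuousOn f (ball 0 1)) {z : CSpace n} (hz : ‖z‖ < 1) :
    ∃ u ∈ closedBall (0 : CSpace n) (1 / 2), hyperbolicSup f z = ‖f (ballInvolution z u)‖ :=
  (isCompact_closedBall 0 (1 / 2)).exists_sSup_image_eq (nonempty_closedBall.2 (by norm_num))
    (continuousOn_norm_comp_ballInvolution hf hz)

variable [NormedSpace ℂ F]

lemma differentiableOn_comp_ballInvolution (hf : DifferentiableOn ℂ f (ball 0 1)) {z : CSpace n}
    (hz : ‖z‖ < 1) : DifferentiableOn ℂ (fun u => f (ballInvolution z u)) (ball 0 1) :=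
  hf.comp (fun _ hu => (hasFDerivAt_ballInvolution hz
    (mem_ball_zero_iff.1 hu).le).differentiableAt.differentiableWithinAt)
    (bijOn_ballInvolution hz).mapsTo

lemma norm_sub_le_pseudoHyp_mul_hyperbolicSup (hf : DifferentiableOn ℂ f (ball 0 1))
    {z w : CSpace n} (hz : ‖z‖ < 1) (hw : ‖w‖ < 1) :
    ‖f z - f w‖ ≤ pseudoHyp z w * (4 * hyperbolicSup f z + 4 * hyperbolicSup f w) := by
  have hz_le := norm_le_hyperbolicSup hf.continuousOn hz
  have hw_le := norm_le_hyperbolicSup hf.continuousOn hw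
  have hρ := pseudoHyp_nonneg z w
  rcases lt_or_ge (pseudoHyp z w) (1 / 2) with hnear | hfar
  · have hschwarz := norm_sub_le_four_mul_of_bounded (differentiableOn_comp_ballInvolution hf hz)
      (fun u hu => norm_comp_ballInvolution_le_hyperbolicSup hf.continuousOn hz hu) hnear
    rw [ballInvolution_zero hz, ballInvolution_ballInvolution hz hw.le, norm_sub_rev] at hschwarz
    calc ‖f z - f w‖ ≤ pseudoHyp z w * (4 * hyperbolicSup f z) := by
          rw [mul_comm]; exact hschwarz
      _ ≤ pseudoHyp z w * (4 * hyperbolicSup f z + 4 * hyperbolicSup f w) := by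
          gcongr
          linarith [norm_nonneg (f w)]
  · calc ‖f z - f w‖ ≤ hyperbolicSup f z + hyperbolicSup f w :=
          (norm_sub_le _ _).trans (add_le_add hz_le hw_le)
      _ ≤ pseudoHyp z w * (4 * hyperbolicSup f z + 4 * hyperbolicSup f w) := by
          nlinarith [norm_nonneg (f z), norm_nonneg (f w)]

variable [CompleteSpace F]

lemma exists_enorm_hyperbolicSup_rpow_le {p : ℝ} (hp : 0 < p) :
    ∃ C ≠ ∞, ∀ (f : CSpace n → F), DifferentiableOn ℂ f (ball 0 1) → ∀ z ∈ ball (0 : CSpace n) 1,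
      ‖hyperbolicSup f z‖ₑ ^ p ≤ C * ∫⁻ v in ball 0 (3 / 4), ‖f (ballInvolution z v)‖ₑ ^ p := by
  obtain ⟨C, hC, hmean⟩ := exists_enorm_rpow_mul_measure_ball_le (E := CSpace n) (F := F) volume hp
  have hpos : volume (ball (0 : CSpace n) (1 / 4)) ≠ 0 := (measure_ball_pos _ _ (by norm_num)).ne'
  have htop : volume (ball (0 : CSpace n) (1 / 4)) ≠ ∞ := measure_ball_lt_top.ne
  refine ⟨C / volume (ball (0 : CSpace n) (1 / 4)), ENNReal.div_ne_top hC hpos,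
    fun f hf z hz => ?_⟩
  obtain ⟨u, hu, hsup⟩ := exists_hyperbolicSup_eq hf.continuousOn (mem_ball_zero_iff.1 hz)
  have hu' : dist u 0 ≤ 1 / 2 := hu
  have hmean_u := hmean _ u (1 / 4) (by norm_num)
    ((differentiableOn_comp_ballInvolution hf (mem_ball_zero_iff.1 hz)).mono
      (closedBall_subset_ball' (by linarith)))
  rw [hsup, enorm_norm, ← ENNReal.mul_div_right_comm,
    ENNReal.le_div_iff_mul_le (.inl hpos) (.inl htop), ← Measure.addHaar_ball_center volume u]
  refine hmean_u.trans (mul_le_mul_right (lintegral_mono_set ?_) _)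
  exact ball_subset_ball' (by linarith)

lemma memLp_hyperbolicSup {p α : ℝ} (hp : 0 < p) (hα : -1 < α)
    (hf : DifferentiableOn ℂ f (ball 0 1))
    (hfp : MemLp f (ENNReal.ofReal p) (weightedVolume n α)) :
    MemLp (hyperbolicSup f) (ENNReal.ofReal p) (weightedVolume n α) := by
  rw [memLp_weightedVolume_iff hp hα hf.continuousOn,
    ← setLIntegral_ball_one_sub_sq_lt_top_iff] at hfp
  rw [memLp_weightedVolume_iff hp hα (continuousOn_hyperbolicSup hf.continuousOn),
    ← setLIntegral_ball_one_sub_sq_lt_top_iff]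
  obtain ⟨C, hC, hle⟩ := exists_enorm_hyperbolicSup_rpow_le (n := n) (F := F) hp
  have hmeas : AEMeasurable (fun u => ‖f u‖ₑ ^ p) (volume.restrict (ball 0 1)) :=
    ((hf.continuousOn.aestronglyMeasurable measurableSet_ball).enorm).pow_const p
  calc ∫⁻ z in ball 0 1, ‖hyperbolicSup f z‖ₑ ^ p * ENNReal.ofReal ((1 - ‖z‖ ^ 2) ^ α)
      ≤ ∫⁻ z in ball 0 1, C * (ENNReal.ofReal ((1 - ‖z‖ ^ 2) ^ α) *
          ∫⁻ v in ball 0 (3 / 4), ‖f (ballInvolution z v)‖ₑ ^ p) :=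
        setLIntegral_mono' measurableSet_ball fun z hz => by
          rw [mul_left_comm, mul_comm]
          exact mul_le_mul_right (hle f hf z hz) _
    _ = C * ∫⁻ z in ball 0 1, ENNReal.ofReal ((1 - ‖z‖ ^ 2) ^ α) *
          ∫⁻ v in ball 0 (3 / 4), ‖f (ballInvolution z v)‖ₑ ^ p :=
        lintegral_const_mul' _ _ hC
    _ < ∞ := ENNReal.mul_lt_top hC.lt_top <|
        (lintegral_rpow_mul_setLIntegral_comp_ballInvolution_le
          (by linarith [(Nat.cast_nonneg n : (0 : ℝ) ≤ n)]) (by norm_num) hmeas).trans_lt <|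
        ENNReal.mul_lt_top ENNReal.ofReal_lt_top (ENNReal.mul_lt_top hfp measure_ball_lt_top)

end HyperbolicSup

section Equivalence

variable {n : ℕ}

lemma pseudoHyp_le_div_left {z w : CSpace n} (hz : ‖z‖ < 1) (hw : ‖w‖ < 1) :
    pseudoHyp z w ≤ ‖z - w‖ / (1 - ‖z‖) :=
  (norm_ballInvolution_le hz hw.le).trans <| div_le_div_of_nonneg_left (norm_nonneg _)
    (sub_pos.2 hz) (one_sub_norm_le_norm_one_sub_inner hw.le)

lemma pseudoHyp_le_div_right {z w : CSpace n} (hz : ‖z‖ < 1) (hw : ‖w‖ < 1) :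
    pseudoHyp z w ≤ ‖z - w‖ / (1 - ‖w‖) := by
  refine (norm_ballInvolution_le hz hw.le).trans <| div_le_div_of_nonneg_left (norm_nonneg _)
    (sub_pos.2 hw) ?_
  rw [norm_one_sub_inner_comm]
  exact one_sub_norm_le_norm_one_sub_inner hz.le

lemma le_half_log_div {x : ℝ} (h0 : 0 ≤ x) (h1 : x < 1) :
    x ≤ 1 / 2 * Real.log ((1 + x) / (1 - x)) := by
  have hseries := Real.hasSum_log_sub_log_of_abs_lt_one (x := x) (by rwa [abs_of_nonneg h0])
  have hfirst : 2 * x ≤ Real.log (1 + x) - Real.log (1 - x) := by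
    simpa using le_hasSum hseries 0 fun k _ => by positivity
  rw [Real.log_div (by linarith) (by linarith)]
  linarith

lemma pseudoHyp_le_bergmanDist {z w : CSpace n} (hz : ‖z‖ < 1) (hw : ‖w‖ < 1) :
    pseudoHyp z w ≤ bergmanDist z w :=
  le_half_log_div (pseudoHyp_nonneg z w) (norm_ballInvolution_lt_one hz hw)

lemma bergmanDist_le_of_pseudoHyp_le {z w : CSpace n} {κ : ℝ} (h : pseudoHyp z w ≤ κ)
    (hκ : κ < 1) : bergmanDist z w ≤ 1 / 2 * Real.log ((1 + κ) / (1 - κ)) := by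
  have hρ : 0 ≤ ‖ballInvolution z w‖ := norm_nonneg _
  have hρκ : ‖ballInvolution z w‖ ≤ κ := h
  have hρ1 : 0 < 1 - ‖ballInvolution z w‖ := by linarith
  have : 0 < 1 - κ := by linarith
  have : 0 ≤ 1 + κ := by linarith
  unfold bergmanDist
  gcongr

lemma mul_add_le_mul_abs_add_abs {x y a b : ℝ} (hx : 0 ≤ x) (hxy : x ≤ y) :
    x * (a + b) ≤ y * (|a| + |b|) :=
  calc x * (a + b) ≤ x * (|a| + |b|) := by gcongr <;> exact le_abs_self _
    _ ≤ y * (|a| + |b|) := by gcongr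

variable {F : Type*} [NormedAddCommGroup F] {p α : ℝ} {f : CSpace n → F} {g : CSpace n → ℝ}

lemma norm_sub_le_bergmanDist_mul_of_pseudoHyp
    (hle : ∀ z ∈ ball 0 1, ∀ w ∈ ball 0 1, ‖f z - f w‖ ≤ pseudoHyp z w * (g z + g w)) :
    ∀ z ∈ ball 0 1, ∀ w ∈ ball 0 1, ‖f z - f w‖ ≤ bergmanDist z w * (|g z| + |g w|) :=
  fun z hz w hw => (hle z hz w hw).trans <| mul_add_le_mul_abs_add_abs (pseudoHyp_nonneg z w)
    (pseudoHyp_le_bergmanDist (mem_ball_zero_iff.1 hz) (mem_ball_zero_iff.1 hw))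

lemma norm_sub_le_norm_sub_mul_of_pseudoHyp
    (hle : ∀ z ∈ ball 0 1, ∀ w ∈ ball 0 1, ‖f z - f w‖ ≤ pseudoHyp z w * (g z + g w)) :
    ∀ z ∈ ball 0 1, ∀ w ∈ ball 0 1,
      ‖f z - f w‖ ≤ ‖z - w‖ * (|g z| / (1 - ‖z‖) + |g w| / (1 - ‖w‖)) := fun z hz w hw =>
  have hz' := mem_ball_zero_iff.1 hz
  have hw' := mem_ball_zero_iff.1 hw
  calc ‖f z - f w‖ ≤ pseudoHyp z w * (|g z| + |g w|) :=
        (hle z hz w hw).trans (mul_add_le_mul_abs_add_abs (pseudoHyp_nonneg z w) le_rfl)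
    _ = pseudoHyp z w * |g z| + pseudoHyp z w * |g w| := mul_add _ _ _
    _ ≤ ‖z - w‖ / (1 - ‖z‖) * |g z| + ‖z - w‖ / (1 - ‖w‖) * |g w| := by
        gcongr
        exacts [pseudoHyp_le_div_left hz' hw', pseudoHyp_le_div_right hz' hw']
    _ = ‖z - w‖ * (|g z| / (1 - ‖z‖) + |g w| / (1 - ‖w‖)) := by ring

lemma memLp_of_norm_sub_le_of_radial (hp : 0 < p) (hα : -1 < α) (hf : ContinuousOn f (ball 0 1))
    (hg : ContinuousOn g (ball 0 1)) (hgp : MemLp g (ENNReal.ofReal p) (weightedVolume n α))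
    (hle : ∀ z ∈ ball 0 1, ∀ w ∈ ball 0 1, 1 - ‖w‖ = 2 * (1 - ‖z‖) → ‖z - w‖ = 1 - ‖z‖ →
      ‖f z - f w‖ ≤ g z + g w) :
    MemLp f (ENNReal.ofReal p) (weightedVolume n α) := by
  rw [memLp_weightedVolume_iff hp hα hg] at hgp
  rw [memLp_weightedVolume_iff hp hα hf]
  exact setLIntegral_ball_rpow_mul_rpow_lt_top_of_norm_sub_le volume hp hα one_lt_two hf hg
    (fun z hz w hw hzw hray => hle z hz w hw hzw (by linarith)) hgp

lemma memLp_of_norm_sub_le_bergmanDist_mul (hp : 0 < p) (hα : -1 < α)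
    (hf : ContinuousOn f (ball 0 1)) (hg : ContinuousOn g (ball 0 1))
    (hgp : MemLp g (ENNReal.ofReal p) (weightedVolume n α))
    (hle : ∀ z ∈ ball 0 1, ∀ w ∈ ball 0 1, ‖f z - f w‖ ≤ bergmanDist z w * (g z + g w)) :
    MemLp f (ENNReal.ofReal p) (weightedVolume n α) := by
  set b : ℝ := 1 / 2 * Real.log ((1 + 1 / 2) / (1 - 1 / 2))
  refine memLp_of_norm_sub_le_of_radial hp hα hf (continuousOn_const.mul hg.abs)
    (hgp.abs.const_mul b) fun z hz w hw hzw hray => ?_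
  have hz' := mem_ball_zero_iff.1 hz
  have hw' := mem_ball_zero_iff.1 hw
  have hρ : pseudoHyp z w ≤ 1 / 2 := by
    refine (pseudoHyp_le_div_right hz' hw').trans_eq ?_
    rw [hray, hzw, div_mul_cancel_right₀ (sub_pos.2 hz').ne', one_div]
  have hβ0 := (pseudoHyp_nonneg z w).trans (pseudoHyp_le_bergmanDist hz' hw')
  calc ‖f z - f w‖ ≤ b * (|g z| + |g w|) := (hle z hz w hw).trans <|
        mul_add_le_mul_abs_add_abs hβ0 (bergmanDist_le_of_pseudoHyp_le hρ one_half_lt_one)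
    _ = b * |g z| + b * |g w| := mul_add _ _ _

lemma memLp_of_norm_sub_le_norm_sub_mul (hp : 0 < p) (hα : -1 < α)
    (hf : ContinuousOn f (ball 0 1)) (hg : ContinuousOn g (ball 0 1))
    (hgp : MemLp g (ENNReal.ofReal p) (weightedVolume n (p + α)))
    (hle : ∀ z ∈ ball 0 1, ∀ w ∈ ball 0 1, ‖f z - f w‖ ≤ ‖z - w‖ * (g z + g w)) :
    MemLp f (ENNReal.ofReal p) (weightedVolume n α) := by
  have hG : ContinuousOn (fun z => (1 - ‖z‖) * |g z|) (ball 0 1) :=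
    ContinuousOn.mul (by fun_prop) hg.abs
  have hGp : MemLp (fun z => (1 - ‖z‖) * |g z|) (ENNReal.ofReal p) (weightedVolume n α) := by
    have hcancel : Set.EqOn (fun z => (1 - ‖z‖) * |g z| / (1 - ‖z‖)) (fun z => |g z|)
        (ball 0 1) := fun z hz =>
      mul_div_cancel_left₀ _ (sub_pos.2 (mem_ball_zero_iff.1 hz)).ne'
    have hpα : -1 < p + α := by linarith
    rw [← memLp_div_one_sub_norm_iff hp hα hG,
      memLp_weightedVolume_iff hp hpα (hg.abs.congr hcancel)]
    refine (setLIntegral_congr_fun measurableSet_ball fun z hz => ?_).trans_lt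
      ((memLp_weightedVolume_iff hp hpα hg.abs).1 hgp.abs)
    exact congrArg (‖·‖ₑ ^ p * _) (hcancel hz)
  refine memLp_of_norm_sub_le_of_radial hp hα hf hG hGp fun z hz w hw hzw hray => ?_
  have hz' : 0 < 1 - ‖z‖ := sub_pos.2 (mem_ball_zero_iff.1 hz)
  calc ‖f z - f w‖ ≤ (1 - ‖z‖) * (|g z| + |g w|) := (hle z hz w hw).trans <|
        mul_add_le_mul_abs_add_abs (norm_nonneg _) hray.le
    _ = (1 - ‖z‖) * |g z| + (1 - ‖z‖) * |g w| := mul_add _ _ _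
    _ ≤ (1 - ‖z‖) * |g z| + (1 - ‖w‖) * |g w| := by gcongr; linarith

end Equivalence

theorem theorem13_general {F : Type*} [NormedAddCommGroup F] [NormedSpace ℂ F] [CompleteSpace F]
    (n : ℕ) (p α : ℝ) (hp : 0 < p) (hα : -1 < α)
    (f : CSpace n → F) (hf : DifferentiableOn ℂ f (unitBall n)) :
    List.TFAE [
      MemLp f (ENNReal.ofReal p) (weightedVolume n α),
      ∃ g : CSpace n → ℝ, ContinuousOn g (unitBall n) ∧
        MemLp g (ENNReal.ofReal p) (weightedVolume n α) ∧
        ∀ z ∈ unitBall n, ∀ w ∈ unitBall n, ‖f z - f w‖ ≤ pseudoHyp z w * (g z + g w),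
      ∃ g : CSpace n → ℝ, ContinuousOn g (unitBall n) ∧
        MemLp g (ENNReal.ofReal p) (weightedVolume n α) ∧
        ∀ z ∈ unitBall n, ∀ w ∈ unitBall n, ‖f z - f w‖ ≤ bergmanDist z w * (g z + g w),
      ∃ g : CSpace n → ℝ, ContinuousOn g (unitBall n) ∧
        MemLp g (ENNReal.ofReal p) (weightedVolume n (p + α)) ∧
        ∀ z ∈ unitBall n, ∀ w ∈ unitBall n, ‖f z - f w‖ ≤ ‖z - w‖ * (g z + g w)] := by
  simp only [unitBall] at hf ⊢
  tfae_have 1 → 2 := fun hfp =>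
    ⟨fun z => 4 * hyperbolicSup f z,
      continuousOn_const.mul (continuousOn_hyperbolicSup hf.continuousOn),
      (memLp_hyperbolicSup hp hα hf hfp).const_mul 4, fun z hz w hw =>
        norm_sub_le_pseudoHyp_mul_hyperbolicSup hf (mem_ball_zero_iff.1 hz)
          (mem_ball_zero_iff.1 hw)⟩
  tfae_have 2 → 3 := fun ⟨g, hg, hgp, hle⟩ =>
    ⟨fun z => |g z|, hg.abs, hgp.abs, norm_sub_le_bergmanDist_mul_of_pseudoHyp hle⟩
  tfae_have 2 → 4 := fun ⟨g, hg, hgp, hle⟩ =>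
    ⟨fun z => |g z| / (1 - ‖z‖),
      hg.abs.div (by fun_prop) fun z hz => (sub_pos.2 (mem_ball_zero_iff.1 hz)).ne',
      (memLp_div_one_sub_norm_iff hp hα hg.abs).2 hgp.abs,
      norm_sub_le_norm_sub_mul_of_pseudoHyp hle⟩
  tfae_have 3 → 1 := fun ⟨_, hg, hgp, hle⟩ =>
    memLp_of_norm_sub_le_bergmanDist_mul hp hα hf.continuousOn hg hgp hle
  tfae_have 4 → 1 := fun ⟨_, hg, hgp, hle⟩ =>
    memLp_of_norm_sub_le_norm_sub_mul hp hα hf.continuousOn hg hgp hle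
  tfae_finish

theorem theorem13 (n : ℕ) (p α : ℝ) (hp : 0 < p) (hα : -1 < α)
    (f : CSpace n → ℂ) (hf : DifferentiableOn ℂ f (unitBall n)) :
    List.TFAE [
      MemBergman n p α f,
      ∃ g : CSpace n → ℝ, ContinuousOn g (unitBall n) ∧
        MemLp g (ENNReal.ofReal p) (weightedVolume n α) ∧
        ∀ z ∈ unitBall n, ∀ w ∈ unitBall n, ‖f z - f w‖ ≤ pseudoHyp z w * (g z + g w),
      ∃ g : CSpace n → ℝ, ContinuousOn g (unitBall n) ∧
        MemLp g (ENNReal.ofReal p) (weightedVolume n α) ∧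
        ∀ z ∈ unitBall n, ∀ w ∈ unitBall n, ‖f z - f w‖ ≤ bergmanDist z w * (g z + g w),
      ∃ g : CSpace n → ℝ, ContinuousOn g (unitBall n) ∧
        MemLp g (ENNReal.ofReal p) (weightedVolume n (p + α)) ∧
        ∀ z ∈ unitBall n, ∀ w ∈ unitBall n, ‖f z - f w‖ ≤ ‖z - w‖ * (g z + g w)] := by
  simpa only [MemBergman, hf, true_and] using theorem13_general n p α hp hα f hf
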